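/- Let $(\alpha_1,\alpha_2,\phi,g)$ be a metric contact pair (MCP) of type $(p,q)$ on a smooth manifold $M$ of dimension $2p+2q+2$, with Reeb vector fields $Z_1,Z_2$. That is, with the convention $d\alpha(X,Y)=\tfrac12\big(X\alpha(Y)-Y\alpha(X)-\alpha([X,Y])\big)$: $\alpha_1,\alpha_2$ are one-forms such that $\alpha_1\wedge(d\alpha_1)^p\wedge\alpha_2\wedge(d\alpha_2)^q$ is a volume form, $(d\alpha_1)^{p+1}=0$ and $(d\alpha_2)^{q+1}=0$; $Z_1,Z_2$ are the vector fields with $\alpha_i(Z_j)=\delta_{ij}$ and $i_{Z_j}d\alpha_i=0$ for $i,j=1,2$; $\phi$ is a $(1,1)$-tensor field with $\phi^2=-\mathrm{Id}+\alpha_1\otimes Z_1+\alpha_2\otimes Z_2$ and $\phi Z_1=\phi Z_2=0$; and $g$ is a Riemannian metric with $g(X,\phi Y)=(d\alpha_1+d\alpha_2)(X,Y)$ and $g(X,Z_i)=\alpha_i(X)$. All objects are smooth. Put $T\mathcal F_i=\ker\alpha_i\cap\ker d\alpha_i$ and assume that $\phi$ is decomposable, i.e. $\phi(T\mathcal F_i)\subset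 T\mathcal F_i$ for $i=1,2$. Let $Z=Z_1+Z_2$, let $\nabla$ be the Levi-Civita connection of $g$, and let $h=\tfrac12\mathcal L_Z\phi$. Then $h$ also satisfies $h(T\mathcal F_i)\subset T\mathcal F_i$ for $i=1,2$. Denote by $\phi_1,h_1$ the endomorphisms of $T\mathcal F_2$, and by $\phi_2,h_2$ the endomorphisms of $T\mathcal F_1$, induced by $\phi$ and $h$. Then: (a) $\mathcal L_{Z_1}\phi$, $\mathcal L_{Z_2}\phi$, $h$, $h_1$ and $h_2$ are symmetric operators with respect to $g$; (b) $\nabla_XZ=-\phi X-\phi hX$ for every vector field $X$; (c) $h\circ\phi+\phi\circ h=0$ and $h_i\circ\phi_i+\phi_i\circ h_i=0$ for $i=1,2$; (d) $\operatorname{tr}h=\operatorname{tr}h_1=\operatorname{tr}h_2=0$; (e) $\alpha_i\circ h=0$ and $\alpha_i\circ h_j=0$ for all $i,j=1,2$. -/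

import Mathlib

open Bundle Manifold VectorField Module
open scoped ContDiff

noncomputable section

set_option linter.unusedSectionVars false

namespace MetricContactPair

variable {E : Type*} [NormedAddCommGroup E] [NormedSpace ℝ E]
  {M : Type*} [TopologicalSpace M] [ChartedSpace E M] [IsManifold 𝓘(ℝ, E) ∞ M]

/-! ### Smooth tensor fields -/

variable (E M) in
/-- Smooth vector fields on `M`. -/
abbrev VField : Type _ :=
  ContMDiffSection 𝓘(ℝ, E) E ∞ (fun x : M => TangentSpace 𝓘(ℝ, E) x)

variable (E M) in
/-- Smooth one-forms on `M`. -/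
abbrev OneForm : Type _ :=
  ContMDiffSection 𝓘(ℝ, E) (E →L[ℝ] ℝ) ∞ (fun x : M => TangentSpace 𝓘(ℝ, E) x →L[ℝ] ℝ)

variable (E M) in
/-- Smooth tensor fields of type `(1,1)` on `M`, as fields of endomorphisms of the tangent
spaces. -/
abbrev EndField : Type _ :=
  ContMDiffSection 𝓘(ℝ, E) (E →L[ℝ] E) ∞
    (fun x : M => TangentSpace 𝓘(ℝ, E) x →L[ℝ] TangentSpace 𝓘(ℝ, E) x)

variable (E M) in
/-- Smooth Riemannian metrics on `M`. -/
abbrev Metric : Type _ :=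
  ContMDiffRiemannianMetric 𝓘(ℝ, E) ∞ E (fun x : M => TangentSpace 𝓘(ℝ, E) x)

theorem VField.mdiffAt (X : VField E M) (x : M) : MDiffAt (T% fun y => X y) x :=
  X.contMDiff.mdifferentiableAt (by simp)

theorem OneForm.mdiffAt_apply (α : OneForm E M) {X : Π x : M, TangentSpace 𝓘(ℝ, E) x} {x : M}
    (hX : MDiffAt (T% X) x) : MDiffAt (fun y => α y (X y)) x := by
  have h := MDifferentiableAt.clm_bundle_apply (b := fun y : M => y)
    (E₂ := Bundle.Trivial M ℝ) (F₂ := ℝ) (α.contMDiff.mdifferentiableAt (x := x) (by simp)) hX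
  rw [mdifferentiableAt_totalSpace] at h
  exact h.2

theorem EndField.mdiffAt_apply (φ : EndField E M) {X : Π x : M, TangentSpace 𝓘(ℝ, E) x} {x : M}
    (hX : MDiffAt (T% X) x) : MDiffAt (T% fun y => φ y (X y)) x :=
  MDifferentiableAt.clm_bundle_apply (b := fun y : M => y)
    (φ.contMDiff.mdifferentiableAt (x := x) (by simp)) hX

theorem Metric.mdiffAt_apply (g : Metric E M) {X Y : Π x : M, TangentSpace 𝓘(ℝ, E) x} {x : M}
    (hX : MDiffAt (T% X) x) (hY : MDiffAt (T% Y) x) :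
    MDiffAt (fun y => g.inner y (X y) (Y y)) x := by
  have h := MDifferentiableAt.clm_bundle_apply₂ (b := fun y : M => y)
    (E₃ := Bundle.Trivial M ℝ) (F₃ := ℝ) (g.contMDiff.mdifferentiableAt (x := x) (by simp)) hX hY
  rw [mdifferentiableAt_totalSpace] at h
  exact h.2

variable [FiniteDimensional ℝ E]

/-! ### Exterior derivative of one-forms and Lie derivative of endomorphism fields -/

/-- The expression `(X(α(Y)) - Y(α(X)) - α([X, Y])) / 2` at the point `x`. -/
def dFormAux (α : OneForm E M) (x : M) (X Y : Π x : M, TangentSpace 𝓘(ℝ, E) x) : ℝ :=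
  (1 / 2 : ℝ) * (mvfderiv 𝓘(ℝ, E) (fun y => α y (Y y)) x (X x)
    - mvfderiv 𝓘(ℝ, E) (fun y => α y (X y)) x (Y x)
    - α x (mlieBracket 𝓘(ℝ, E) X Y x))

theorem dFormAux_tensorial_left (α : OneForm E M) (x : M)
    (Y : Π x : M, TangentSpace 𝓘(ℝ, E) x) (_ : MDiffAt (T% Y) x) :
    TensorialAt 𝓘(ℝ, E) E (dFormAux α x · Y) x where
  smul {f X} hf hX := by
    have := FiniteDimensional.complete ℝ E
    have h := α.mdiffAt_apply hX
    simp [dFormAux, mlieBracket_smul_left hf hX, mvfderiv_fun_mul hf h]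
    ring
  add {X X'} hX hX' := by
    have := FiniteDimensional.complete ℝ E
    have h := α.mdiffAt_apply hX
    have h' := α.mdiffAt_apply hX'
    simp [dFormAux, mlieBracket_add_left hX hX', mvfderiv_fun_add h h']
    ring

theorem dFormAux_tensorial_right (α : OneForm E M) (x : M)
    (X : Π x : M, TangentSpace 𝓘(ℝ, E) x) (_ : MDiffAt (T% X) x) :
    TensorialAt 𝓘(ℝ, E) E (dFormAux α x X ·) x where
  smul {f Y} hf hY := by
    have := FiniteDimensional.complete ℝ E
    have h := α.mdiffAt_apply hY
    simp [dFormAux, mlieBracket_smul_right hf hY, mvfderiv_fun_mul hf h]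
    ring
  add {Y Y'} hY hY' := by
    have := FiniteDimensional.complete ℝ E
    have h := α.mdiffAt_apply hY
    have h' := α.mdiffAt_apply hY'
    simp [dFormAux, mlieBracket_add_right hY hY', mvfderiv_fun_add h h']
    ring

/-- The exterior derivative of a one-form, with the normalisation
`dα(X, Y) = (X(α(Y)) - Y(α(X)) - α([X, Y])) / 2` that is customary in contact metric geometry. -/
def dForm (α : OneForm E M) (x : M) :
    TangentSpace 𝓘(ℝ, E) x →L[ℝ] TangentSpace 𝓘(ℝ, E) x →L[ℝ] ℝ :=
  TensorialAt.mkHom₂ (dFormAux α x) x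
    (fun Y hY => dFormAux_tensorial_left α x Y hY)
    (fun X hX => dFormAux_tensorial_right α x X hX)

theorem dForm_apply (α : OneForm E M) {x : M} {X Y : Π x : M, TangentSpace 𝓘(ℝ, E) x}
    (hX : MDiffAt (T% X) x) (hY : MDiffAt (T% Y) x) :
    dForm α x (X x) (Y x) =
      (1 / 2 : ℝ) * (mvfderiv 𝓘(ℝ, E) (fun y => α y (Y y)) x (X x)
        - mvfderiv 𝓘(ℝ, E) (fun y => α y (X y)) x (Y x)
        - α x (mlieBracket 𝓘(ℝ, E) X Y x)) :=
  TensorialAt.mkHom₂_apply (dFormAux_tensorial_left α x) (dFormAux_tensorial_right α x) hX hY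

theorem dForm_self (α : OneForm E M) (x : M) (v : TangentSpace 𝓘(ℝ, E) x) :
    dForm α x v v = 0 := by
  simp [dForm, TensorialAt.mkHom₂_apply_eq_extend, dFormAux]

/-- The expression `[Z, φ X] - φ [Z, X]` at the point `x`. -/
def lieDerivAux (Z : VField E M) (φ : EndField E M) (x : M)
    (X : Π x : M, TangentSpace 𝓘(ℝ, E) x) : TangentSpace 𝓘(ℝ, E) x :=
  mlieBracket 𝓘(ℝ, E) (fun y => Z y) (fun y => φ y (X y)) x
    - φ x (mlieBracket 𝓘(ℝ, E) (fun y => Z y) X x)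

theorem lieDerivAux_tensorial (Z : VField E M) (φ : EndField E M) (x : M) :
    TensorialAt 𝓘(ℝ, E) E (lieDerivAux Z φ x) x where
  smul {f X} hf hX := by
    have := FiniteDimensional.complete ℝ E
    have h := φ.mdiffAt_apply hX
    have e : (fun y => φ y ((f • X) y)) = f • fun y => φ y (X y) := by ext1 y; simp
    simp only [lieDerivAux, e, mlieBracket_smul_right hf hX, mlieBracket_smul_right hf h, map_add,
      map_smul]
    module
  add {X X'} hX hX' := by
    have := FiniteDimensional.complete ℝ E
    have h := φ.mdiffAt_apply hX
    have h' := φ.mdiffAt_apply hX'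
    have e : (fun y => φ y ((X + X') y)) = (fun y => φ y (X y)) + fun y => φ y (X' y) := by
      ext1 y; simp
    simp only [lieDerivAux, e, mlieBracket_add_right hX hX', mlieBracket_add_right h h', map_add]
    module

/-- The Lie derivative `𝓛_Z φ`, that is, `(𝓛_Z φ) X = [Z, φ X] - φ [Z, X]`. -/
def lieDeriv (Z : VField E M) (φ : EndField E M) (x : M) :
    TangentSpace 𝓘(ℝ, E) x →L[ℝ] TangentSpace 𝓘(ℝ, E) x :=
  TensorialAt.mkHom (lieDerivAux Z φ x) x (lieDerivAux_tensorial Z φ x)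

theorem lieDeriv_apply (Z : VField E M) (φ : EndField E M) {x : M}
    {X : Π x : M, TangentSpace 𝓘(ℝ, E) x} (hX : MDiffAt (T% X) x) :
    lieDeriv Z φ x (X x) =
      mlieBracket 𝓘(ℝ, E) (fun y => Z y) (fun y => φ y (X y)) x
        - φ x (mlieBracket 𝓘(ℝ, E) (fun y => Z y) X x) :=
  TensorialAt.mkHom_apply (lieDerivAux_tensorial Z φ x) hX

/-! ### The Levi-Civita connection -/

/-- Half of the right-hand side of the Koszul formula for `2 g(∇_X Y, W)` at the point `x`. -/
def koszul (g : Metric E M) (x : M) (Y X W : Π x : M, TangentSpace 𝓘(ℝ, E) x) : ℝ :=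
  (1 / 2 : ℝ) * (mvfderiv 𝓘(ℝ, E) (fun y => g.inner y (Y y) (W y)) x (X x)
    + mvfderiv 𝓘(ℝ, E) (fun y => g.inner y (X y) (W y)) x (Y x)
    - mvfderiv 𝓘(ℝ, E) (fun y => g.inner y (X y) (Y y)) x (W x)
    + g.inner x (mlieBracket 𝓘(ℝ, E) X Y x) (W x)
    - g.inner x (mlieBracket 𝓘(ℝ, E) X W x) (Y x)
    - g.inner x (mlieBracket 𝓘(ℝ, E) Y W x) (X x))

theorem koszul_tensorial_left (g : Metric E M) (x : M) {Y W : Π x : M, TangentSpace 𝓘(ℝ, E) x}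
    (hY : MDiffAt (T% Y) x) (hW : MDiffAt (T% W) x) :
    TensorialAt 𝓘(ℝ, E) E (koszul g x Y · W) x where
  smul {f X} hf hX := by
    have := FiniteDimensional.complete ℝ E
    have h₁ := g.mdiffAt_apply hX hW
    have h₂ := g.mdiffAt_apply hX hY
    simp [koszul, mlieBracket_smul_left hf hX, mvfderiv_fun_mul hf h₁, mvfderiv_fun_mul hf h₂]
    ring
  add {X X'} hX hX' := by
    have := FiniteDimensional.complete ℝ E
    have h₁ := g.mdiffAt_apply hX hW
    have h₂ := g.mdiffAt_apply hX hY
    have h₁' := g.mdiffAt_apply hX' hW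
    have h₂' := g.mdiffAt_apply hX' hY
    simp [koszul, mlieBracket_add_left hX hX', mvfderiv_fun_add h₁ h₁', mvfderiv_fun_add h₂ h₂']
    ring

theorem koszul_tensorial_right (g : Metric E M) (x : M) {Y X : Π x : M, TangentSpace 𝓘(ℝ, E) x}
    (hY : MDiffAt (T% Y) x) (hX : MDiffAt (T% X) x) :
    TensorialAt 𝓘(ℝ, E) E (koszul g x Y X ·) x where
  smul {f W} hf hW := by
    have := FiniteDimensional.complete ℝ E
    have h₁ := g.mdiffAt_apply hY hW
    have h₂ := g.mdiffAt_apply hX hW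
    simp [koszul, mlieBracket_smul_right hf hW, mvfderiv_fun_mul hf h₁, mvfderiv_fun_mul hf h₂,
      g.symm x (W x) (X x), g.symm x (W x) (Y x)]
    ring
  add {W W'} hW hW' := by
    have := FiniteDimensional.complete ℝ E
    have h₁ := g.mdiffAt_apply hY hW
    have h₂ := g.mdiffAt_apply hX hW
    have h₁' := g.mdiffAt_apply hY hW'
    have h₂' := g.mdiffAt_apply hX hW'
    simp [koszul, mlieBracket_add_right hW hW', mvfderiv_fun_add h₁ h₁', mvfderiv_fun_add h₂ h₂']
    ring

theorem tangentSpace_finiteDimensional (x : M) :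
    FiniteDimensional ℝ (TangentSpace 𝓘(ℝ, E) x) :=
  inferInstanceAs (FiniteDimensional ℝ E)

theorem tangentSpace_t2Space (x : M) : T2Space (TangentSpace 𝓘(ℝ, E) x) :=
  inferInstanceAs (T2Space E)

/-- The metric at a point as a bilinear form. -/
def Metric.bilin (g : Metric E M) (x : M) : LinearMap.BilinForm ℝ (TangentSpace 𝓘(ℝ, E) x) :=
  LinearMap.mk₂ ℝ (fun v w => g.inner x v w) (by simp) (by simp) (by simp) (by simp)

theorem Metric.eq_zero (g : Metric E M) (x : M) (v : TangentSpace 𝓘(ℝ, E) x)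
    (h : ∀ w, g.inner x v w = 0) : v = 0 := by
  by_contra hv
  exact (g.pos x v hv).ne' (h v)

theorem Metric.bilin_nondegenerate (g : Metric E M) (x : M) : (g.bilin x).Nondegenerate := by
  refine ⟨fun v h => g.eq_zero x v h, fun v h => g.eq_zero x v fun w => ?_⟩
  rw [g.symm]
  exact h w

/-- The musical isomorphism: the tangent vector `v` with `g(v, w) = ℓ(w)` for all `w`. -/
def Metric.sharp (g : Metric E M) (x : M) :
    (TangentSpace 𝓘(ℝ, E) x →L[ℝ] ℝ) →ₗ[ℝ] TangentSpace 𝓘(ℝ, E) x :=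
  haveI := tangentSpace_finiteDimensional (E := E) x
  ((g.bilin x).toDual (g.bilin_nondegenerate x)).symm.toLinearMap ∘ₗ
    ContinuousLinearMap.coeLM ℝ

theorem Metric.inner_sharp (g : Metric E M) (x : M) (l : TangentSpace 𝓘(ℝ, E) x →L[ℝ] ℝ)
    (w : TangentSpace 𝓘(ℝ, E) x) : g.inner x (g.sharp x l) w = l w := by
  have := tangentSpace_finiteDimensional (E := E) x
  exact LinearMap.BilinForm.apply_toDual_symm_apply (hB := g.bilin_nondegenerate x)
    (l : TangentSpace 𝓘(ℝ, E) x →ₗ[ℝ] ℝ) w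

open scoped Classical in
/-- The field `∇ Y` of endomorphisms `v ↦ ∇_v Y`, for the Levi-Civita connection `∇` of `g`,
determined by the Koszul formula (and zero where `Y` is not differentiable). -/
def leviCivitaFun (g : Metric E M) (Y : Π x : M, TangentSpace 𝓘(ℝ, E) x) (x : M) :
    TangentSpace 𝓘(ℝ, E) x →L[ℝ] TangentSpace 𝓘(ℝ, E) x :=
  haveI := tangentSpace_finiteDimensional (E := E) x
  haveI := tangentSpace_t2Space (E := E) x
  if hY : MDiffAt (T% Y) x then
    LinearMap.toContinuousLinearMap (g.sharp x ∘ₗ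
      (TensorialAt.mkHom₂ (koszul g x Y) x
        (fun _ hW => koszul_tensorial_left g x hY hW)
        (fun _ hX => koszul_tensorial_right g x hY hX)).toLinearMap)
  else 0

theorem inner_leviCivitaFun (g : Metric E M) {x : M} {X Y W : Π x : M, TangentSpace 𝓘(ℝ, E) x}
    (hX : MDiffAt (T% X) x) (hY : MDiffAt (T% Y) x) (hW : MDiffAt (T% W) x) :
    g.inner x (leviCivitaFun g Y x (X x)) (W x) = koszul g x Y X W := by
  have := tangentSpace_finiteDimensional (E := E) x
  have := tangentSpace_t2Space (E := E) x
  rw [leviCivitaFun, dif_pos hY]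
  refine (g.inner_sharp x _ _).trans ?_
  exact TensorialAt.mkHom₂_apply (fun _ hW => koszul_tensorial_left g x hY hW)
        (fun _ hX => koszul_tensorial_right g x hY hX) hX hW

theorem Metric.ext_of_fields (g : Metric E M) {x : M}
    {A B : TangentSpace 𝓘(ℝ, E) x →L[ℝ] TangentSpace 𝓘(ℝ, E) x}
    (h : ∀ X W : Π x : M, TangentSpace 𝓘(ℝ, E) x, MDiffAt (T% X) x → MDiffAt (T% W) x →
      g.inner x (A (X x)) (W x) = g.inner x (B (X x)) (W x)) : A = B := by
  ext1 v
  rw [← sub_eq_zero]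
  refine g.eq_zero x _ fun w => ?_
  have := h (FiberBundle.extend E v) (FiberBundle.extend E w)
    (FiberBundle.mdifferentiableAt_extend ..) (FiberBundle.mdifferentiableAt_extend ..)
  simpa [sub_eq_zero] using this

/-- The Levi-Civita connection of `g`. -/
def leviCivita (g : Metric E M) :
    CovariantDerivative 𝓘(ℝ, E) E (fun x : M => TangentSpace 𝓘(ℝ, E) x) where
  toFun := leviCivitaFun g
  isCovariantDerivativeOnUniv :=
    { add := by
        intro Y Y' x hY hY' _
        have := FiniteDimensional.complete ℝ E
        have hs : MDiffAt (T% (Y + Y')) x := mdifferentiableAt_add_section hY hY'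
        refine g.ext_of_fields fun X W hX hW => ?_
        have h₁ := g.mdiffAt_apply hY hW
        have h₁' := g.mdiffAt_apply hY' hW
        have h₂ := g.mdiffAt_apply hX hY
        have h₂' := g.mdiffAt_apply hX hY'
        rw [inner_leviCivitaFun g hX hs hW, _root_.add_apply, map_add,
          _root_.add_apply, inner_leviCivitaFun g hX hY hW,
          inner_leviCivitaFun g hX hY' hW]
        simp [koszul, mlieBracket_add_right hY hY', mlieBracket_add_left hY hY',
          mvfderiv_fun_add h₁ h₁', mvfderiv_fun_add h₂ h₂']
        ring
      leibniz := by
        intro Y f x hY hf _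
        have := FiniteDimensional.complete ℝ E
        have hs : MDiffAt (T% (f • Y)) x := hf.smul_section hY
        refine g.ext_of_fields fun X W hX hW => ?_
        have h₁ := g.mdiffAt_apply hY hW
        have h₂ := g.mdiffAt_apply hX hY
        rw [inner_leviCivitaFun g hX hs hW, _root_.add_apply,
          _root_.smul_apply, map_add, map_smul, _root_.add_apply,
          _root_.smul_apply, inner_leviCivitaFun g hX hY hW]
        simp [koszul, mlieBracket_smul_right hf hY, mlieBracket_smul_left hf hY,
          mvfderiv_fun_mul hf h₁, mvfderiv_fun_mul hf h₂, g.symm x (Y x) (X x)]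
        ring }

/-- `leviCivita g` is compatible with `g`. -/
theorem leviCivita_metric (g : Metric E M) {x : M} {X Y W : Π x : M, TangentSpace 𝓘(ℝ, E) x}
    (hX : MDiffAt (T% X) x) (hY : MDiffAt (T% Y) x) (hW : MDiffAt (T% W) x) :
    mvfderiv 𝓘(ℝ, E) (fun y => g.inner y (Y y) (W y)) x (X x) =
      g.inner x (leviCivita g Y x (X x)) (W x) + g.inner x (Y x) (leviCivita g W x (X x)) := by
  rw [g.symm x (Y x)]
  refine Eq.trans ?_ (congrArg₂ (· + ·) (inner_leviCivitaFun g hX hY hW)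
    (inner_leviCivitaFun g hX hW hY)).symm
  have e₁ : (fun y => g.inner y (W y) (Y y)) = fun y => g.inner y (Y y) (W y) := by
    ext y; exact g.symm y _ _
  simp only [koszul, e₁]
  rw [mlieBracket_swap_apply (V := W) (W := Y)]
  simp
  ring

/-- `leviCivita g` is torsion-free. -/
theorem leviCivita_torsion (g : Metric E M) {x : M} {X Y : Π x : M, TangentSpace 𝓘(ℝ, E) x}
    (hX : MDiffAt (T% X) x) (hY : MDiffAt (T% Y) x) :
    leviCivita g Y x (X x) - leviCivita g X x (Y x) = mlieBracket 𝓘(ℝ, E) X Y x := by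
  rw [← sub_eq_zero]
  refine g.eq_zero x _ fun w => ?_
  have hW : MDiffAt (T% (FiberBundle.extend E w : Π x : M, TangentSpace 𝓘(ℝ, E) x)) x :=
    FiberBundle.mdifferentiableAt_extend ..
  have h₁ := inner_leviCivitaFun g hX hY hW
  have h₂ := inner_leviCivitaFun g hY hX hW
  have e₁ : (fun y => g.inner y (Y y) (X y)) = fun y => g.inner y (X y) (Y y) := by
    ext y; exact g.symm y _ _
  simp only [koszul, FiberBundle.extend_apply_self, e₁] at h₁ h₂
  rw [mlieBracket_swap_apply (V := Y) (W := X)] at h₂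
  simp only [map_sub, _root_.sub_apply, map_neg, _root_.neg_apply]
    at h₁ h₂ ⊢
  refine (congrArg₂ (fun a b => a - b - _) h₁ h₂).trans ?_
  ring

/-! ### Wedge products at a point -/

section Wedge

variable {V : Type*} [AddCommGroup V] [Module ℝ V]

/-- The wedge product of alternating forms. -/
def wedge {m n : ℕ} (a : V [⋀^Fin m]→ₗ[ℝ] ℝ) (b : V [⋀^Fin n]→ₗ[ℝ] ℝ) :
    V [⋀^Fin (m + n)]→ₗ[ℝ] ℝ :=
  ((LinearMap.mul' ℝ ℝ).compAlternatingMap (a.domCoprod b)).domDomCongr finSumFinEquiv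

/-- The `k`-th wedge power of a two-form. -/
def wedgePow (w : V [⋀^Fin 2]→ₗ[ℝ] ℝ) : (k : ℕ) → V [⋀^Fin (2 * k)]→ₗ[ℝ] ℝ
  | 0 => AlternatingMap.constOfIsEmpty ℝ V (Fin 0) 1
  | k + 1 => wedge (wedgePow w k) w

/-- A linear form as an alternating form of degree one. -/
def oneAlt (a : V →ₗ[ℝ] ℝ) : V [⋀^Fin 1]→ₗ[ℝ] ℝ :=
  AlternatingMap.ofSubsingleton ℝ V ℝ (0 : Fin 1) a

/-- A bilinear form with `b v v = 0` as an alternating form of degree two. -/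
def twoAlt (b : V →ₗ[ℝ] V →ₗ[ℝ] ℝ) (hb : ∀ v, b v v = 0) : V [⋀^Fin 2]→ₗ[ℝ] ℝ where
  toFun v := b (v 0) (v 1)
  map_update_add' v i x y := by fin_cases i <;> simp
  map_update_smul' v i c x := by fin_cases i <;> simp
  map_eq_zero_of_eq' v i j h hij := by
    fin_cases i <;> fin_cases j <;> simp_all

end Wedge

/-- The value of `α` at `x` as an alternating form. -/
def OneForm.alt (α : OneForm E M) (x : M) : TangentSpace 𝓘(ℝ, E) x [⋀^Fin 1]→ₗ[ℝ] ℝ :=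
  oneAlt (α x : TangentSpace 𝓘(ℝ, E) x →ₗ[ℝ] ℝ)

/-- The value of `dα` at `x` as an alternating form. -/
def OneForm.dAlt (α : OneForm E M) (x : M) : TangentSpace 𝓘(ℝ, E) x [⋀^Fin 2]→ₗ[ℝ] ℝ :=
  twoAlt (ContinuousLinearMap.coeLM ℝ ∘ₗ (dForm α x).toLinearMap) (dForm_self α x)

/-! ### Metric contact pairs -/

/-- `(α₁, α₂)` is a contact pair of type `(h, k)`: `α₁ ∧ (dα₁)^h ∧ α₂ ∧ (dα₂)^k` is a volume form
(a nowhere vanishing form of top degree), `(dα₁)^(h+1) = 0` and `(dα₂)^(k+1) = 0`. -/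
structure IsContactPair (h k : ℕ) (α₁ α₂ : OneForm E M) : Prop where
  finrank_eq : finrank ℝ E = 2 * h + 2 * k + 2
  volume_ne_zero : ∀ x : M,
    wedge (wedge (wedge (α₁.alt x) (wedgePow (α₁.dAlt x) h)) (α₂.alt x)) (wedgePow (α₂.dAlt x) k) ≠ 0
  pow_eq_zero₁ : ∀ x : M, wedgePow (α₁.dAlt x) (h + 1) = 0
  pow_eq_zero₂ : ∀ x : M, wedgePow (α₂.dAlt x) (k + 1) = 0

/-- The equations that determine the Reeb vector fields `Z₁`, `Z₂` of a contact pair. -/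
structure IsReebPair (α₁ α₂ : OneForm E M) (Z₁ Z₂ : VField E M) : Prop where
  apply₁₁ : ∀ x, α₁ x (Z₁ x) = 1
  apply₂₂ : ∀ x, α₂ x (Z₂ x) = 1
  apply₁₂ : ∀ x, α₁ x (Z₂ x) = 0
  apply₂₁ : ∀ x, α₂ x (Z₁ x) = 0
  d_apply₁₁ : ∀ x v, dForm α₁ x (Z₁ x) v = 0
  d_apply₂₁ : ∀ x v, dForm α₂ x (Z₁ x) v = 0
  d_apply₁₂ : ∀ x v, dForm α₁ x (Z₂ x) v = 0
  d_apply₂₂ : ∀ x v, dForm α₂ x (Z₂ x) v = 0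

/-- `(α₁, α₂, φ)` is a contact pair structure, with Reeb vector fields `Z₁`, `Z₂`. -/
structure IsContactPairStructure (h k : ℕ) (α₁ α₂ : OneForm E M) (Z₁ Z₂ : VField E M)
    (φ : EndField E M) : Prop where
  contactPair : IsContactPair h k α₁ α₂
  reeb : IsReebPair α₁ α₂ Z₁ Z₂
  sq : ∀ x v, φ x (φ x v) = -v + α₁ x v • Z₁ x + α₂ x v • Z₂ x
  apply_reeb₁ : ∀ x, φ x (Z₁ x) = 0
  apply_reeb₂ : ∀ x, φ x (Z₂ x) = 0

/-- `(α₁, α₂, φ, g)` is a metric contact pair of type `(h, k)`, with Reeb vector fields `Z₁`, `Z₂`: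
a contact pair structure with an associated metric. -/
structure IsMCP (h k : ℕ) (α₁ α₂ : OneForm E M) (Z₁ Z₂ : VField E M)
    (φ : EndField E M) (g : Metric E M) : Prop where
  toStructure : IsContactPairStructure h k α₁ α₂ Z₁ Z₂ φ
  inner_apply : ∀ x v w, g.inner x v (φ x w) = dForm α₁ x v w + dForm α₂ x v w
  inner_reeb₁ : ∀ x v, g.inner x v (Z₁ x) = α₁ x v
  inner_reeb₂ : ∀ x v, g.inner x v (Z₂ x) = α₂ x v

/-- The fibre at `x` of the characteristic distribution `ker α ∩ ker dα`. -/
def charDist (α : OneForm E M) (x : M) : Submodule ℝ (TangentSpace 𝓘(ℝ, E) x) :=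
  LinearMap.ker (α x : TangentSpace 𝓘(ℝ, E) x →ₗ[ℝ] ℝ) ⊓
    LinearMap.ker (dForm α x : TangentSpace 𝓘(ℝ, E) x →ₗ[ℝ] TangentSpace 𝓘(ℝ, E) x →L[ℝ] ℝ)

/-- `A` maps the fibres of the characteristic distribution of `α` into themselves. -/
def Preserves (A : Π x : M, TangentSpace 𝓘(ℝ, E) x →L[ℝ] TangentSpace 𝓘(ℝ, E) x)
    (α : OneForm E M) : Prop :=
  ∀ x, ∀ v ∈ charDist α x, (A x : TangentSpace 𝓘(ℝ, E) x →ₗ[ℝ] TangentSpace 𝓘(ℝ, E) x) v ∈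
    charDist α x

/-- The endomorphism of the characteristic distribution of `α` at `x` induced by an endomorphism
field that preserves it. -/
def Preserves.induced {A : Π x : M, TangentSpace 𝓘(ℝ, E) x →L[ℝ] TangentSpace 𝓘(ℝ, E) x}
    {α : OneForm E M} (hA : Preserves A α) (x : M) : charDist α x →ₗ[ℝ] charDist α x :=
  (A x : TangentSpace 𝓘(ℝ, E) x →ₗ[ℝ] TangentSpace 𝓘(ℝ, E) x).restrict (hA x)

/-- `A` is decomposable: it preserves both characteristic distributions. -/
structure IsDecomposable (A : Π x : M, TangentSpace 𝓘(ℝ, E) x →L[ℝ] TangentSpace 𝓘(ℝ, E) x)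
    (α₁ α₂ : OneForm E M) : Prop where
  preserves₁ : Preserves A α₁
  preserves₂ : Preserves A α₂

/-- The component `A₁` of a decomposable `A = A₁ ⊕ A₂`: the endomorphism induced on the
characteristic distribution of `α₂`. -/
def IsDecomposable.fst {A : Π x : M, TangentSpace 𝓘(ℝ, E) x →L[ℝ] TangentSpace 𝓘(ℝ, E) x}
    {α₁ α₂ : OneForm E M} (hA : IsDecomposable A α₁ α₂) (x : M) :
    charDist α₂ x →ₗ[ℝ] charDist α₂ x :=
  hA.preserves₂.induced x

/-- The component `A₂` of a decomposable `A = A₁ ⊕ A₂`: the endomorphism induced on the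
characteristic distribution of `α₁`. -/
def IsDecomposable.snd {A : Π x : M, TangentSpace 𝓘(ℝ, E) x →L[ℝ] TangentSpace 𝓘(ℝ, E) x}
    {α₁ α₂ : OneForm E M} (hA : IsDecomposable A α₁ α₂) (x : M) :
    charDist α₁ x →ₗ[ℝ] charDist α₁ x :=
  hA.preserves₁.induced x

/-- The tensor field `h = (1/2) 𝓛_Z φ`, where `Z = Z₁ + Z₂`. -/
def hTensor (Z₁ Z₂ : VField E M) (φ : EndField E M) (x : M) :
    TangentSpace 𝓘(ℝ, E) x →L[ℝ] TangentSpace 𝓘(ℝ, E) x :=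
  (1 / 2 : ℝ) • lieDeriv (Z₁ + Z₂) φ x

/-- Symmetry of a field of endomorphisms of the tangent spaces with respect to `g`. -/
def IsSymmetricField (g : Metric E M)
    (A : Π x : M, TangentSpace 𝓘(ℝ, E) x →L[ℝ] TangentSpace 𝓘(ℝ, E) x) : Prop :=
  ∀ x v w, g.inner x (A x v) w = g.inner x v (A x w)

/-- Symmetry, with respect to the restriction of `g`, of a field of endomorphisms of the
characteristic distribution of `α`. -/
def IsSymmetricOn (g : Metric E M) (α : OneForm E M)
    (A : Π x : M, charDist α x →ₗ[ℝ] charDist α x) : Prop :=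
  ∀ x (v w : charDist α x), g.inner x (A x v) w = g.inner x v (A x w)

end MetricContactPair
end

/-!
Let `Z` be `Z₁`, `Z₂` or `Z₁ + Z₂`. The functions `αᵢ(Z)` are constant and `i_Z dαᵢ = 0`, so Cartan's
formula gives `𝓛_Z αᵢ = 0` and `𝓛_Z dαᵢ = 0` (`mvfderiv_oneForm_apply`, `mvfderiv_dForm_apply`).
Since `dα₁ + dα₂` is nondegenerate on `ker α₁ ∩ ker α₂`, it follows that `[Z, Zᵢ] = 0`. The claims
are obtained by applying `𝓛_Z` to the structure equations, with `A = 𝓛_Z φ`: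

* `φ² = -Id + α₁ ⊗ Z₁ + α₂ ⊗ Z₂` gives `A φ + φ A = 0` (`IsMCP.lieDeriv_anticomm`);
* `αᵢ ∘ φ = 0` gives `αᵢ ∘ A = 0`;
* `g(X, W) = -(dα₁ + dα₂)(X, φ W) + α₁(X) α₁(W) + α₂(X) α₂(W)` gives
  `(𝓛_Z g)(X, W) = -g(X, φ A W)` (`IsMCP.mvfderiv_inner`). As `𝓛_Z g` is symmetric, so is `φ A`,
  and by the first two points so is `A`. The Koszul formula turns the same identity into
  `∇_X Z = -φ X - φ h X` for `Z = Z₁ + Z₂` (`IsMCP.leviCivita_reeb`);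
* `dαᵢ(φ X, W) + dαᵢ(X, φ W) = 0`, valid when `φ` is decomposable, gives the same identity for `A`,
  whence `A` preserves `T𝓕ᵢ` (`preserves_of_dForm_skew`).

The last structure equation rests on `TM = T𝓕₁ ⊕ T𝓕₂` (`IsMCP.charDist_sup_eq_top`). By a dimension
count this follows from the algebraic fact that a two-form whose `(k + 1)`-st power vanishes has
rank at most `2 k` (`finrank_le_of_wedgePow_eq_zero`): a form of larger rank admits a symplectic
family of `k + 1` pairs, and its `(k + 1)`-st power is positive on these vectors.

The traces vanish because `A J = -J A` and `J² A = -A` imply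
`tr A = -tr (J J A) = -tr (J A J) = tr (J J A) = -tr A`.
-/

namespace MetricContactPair

/-! ### Vector fields as derivations -/

section Derivations

variable {E : Type*} [NormedAddCommGroup E] [NormedSpace ℝ E]
  {M : Type*} [TopologicalSpace M] [ChartedSpace E M]

theorem mvfderiv_congr_of_eventuallyEq {f f' : M → ℝ} {x : M} (h : f =ᶠ[nhds x] f')
    (v : TangentSpace 𝓘(ℝ, E) x) : mvfderiv 𝓘(ℝ, E) f x v = mvfderiv 𝓘(ℝ, E) f' x v := by
  have := h.mfderiv_eq (I := 𝓘(ℝ, E)) (I' := 𝓘(ℝ, ℝ))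
  exact congrArg (fun L : E →L[ℝ] ℝ => L v) this

variable [IsManifold 𝓘(ℝ, E) ∞ M]

/-- The derivative of a smooth function along a smooth vector field is smooth. -/
theorem contMDiffAt_mvfderiv_apply {f : M → ℝ} {X : Π x : M, TangentSpace 𝓘(ℝ, E) x} {x : M}
    (hf : CMDiffAt ∞ f x) (hX : CMDiffAt ∞ (T% X) x) :
    CMDiffAt ∞ (fun y => mvfderiv 𝓘(ℝ, E) f y (X y)) x := by
  have h := hf.mfderiv_const (m := ∞) (by simp)
  have h2 := ContMDiffAt.clm_apply_of_inCoordinates (b₁ := id) (b₂ := f) (v := X)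
    (ϕ := fun y => mfderiv 𝓘(ℝ, E) 𝓘(ℝ, ℝ) f y) (F₁ := E) (F₂ := ℝ)
    (E₁ := fun y : M => TangentSpace 𝓘(ℝ, E) y) (E₂ := fun y : ℝ => TangentSpace 𝓘(ℝ, ℝ) y)
    h hX hf
  rw [contMDiffAt_totalSpace] at h2
  have h3 : ContMDiffAt 𝓘(ℝ, E) 𝓘(ℝ, ℝ) ∞
      (fun y => (mfderiv 𝓘(ℝ, E) 𝓘(ℝ, ℝ) f y (X y) : ℝ)) x := by simpa using h2.2
  exact h3

theorem two_le_infty : (2 : ℕ∞ω) ≤ ∞ := WithTop.coe_le_coe.2 le_top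

theorem eventually_mdifferentiableAt_section {X : Π x : M, TangentSpace 𝓘(ℝ, E) x} {x : M}
    (hX : CMDiffAt ∞ (T% X) x) : ∀ᶠ y in nhds x, MDiffAt (T% X) y := by
  have : IsManifold 𝓘(ℝ, E) (1 + 1) M :=
    .of_le (n := ∞) (by rw [one_add_one_eq_two]; exact two_le_infty)
  have : IsManifold 𝓘(ℝ, E) 1 M := .of_le (n := ∞) (by simp)
  have h := (contMDiffAt_iff_contMDiffAt_nhds (n := 1) (by simp)).1 (hX.of_le (by simp))
  exact h.mono fun y hy => hy.mdifferentiableAt (by simp)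

theorem eventually_mdifferentiableAt {f : M → ℝ} {x : M} (hf : CMDiffAt ∞ f x) :
    ∀ᶠ y in nhds x, MDiffAt f y := by
  have : IsManifold 𝓘(ℝ, E) 1 M := .of_le (n := ∞) (by simp)
  have h := (contMDiffAt_iff_contMDiffAt_nhds (n := 1) (by simp)).1 (hf.of_le (by simp))
  exact h.mono fun y hy => hy.mdifferentiableAt (by simp)

variable [FiniteDimensional ℝ E]

theorem contMDiffAt_mlieBracket {X Y : Π x : M, TangentSpace 𝓘(ℝ, E) x} {x : M}
    (hX : CMDiffAt ∞ (T% X) x) (hY : CMDiffAt ∞ (T% Y) x) :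
    CMDiffAt ∞ (T% (mlieBracket 𝓘(ℝ, E) X Y)) x := by
  have := FiniteDimensional.complete ℝ E
  have : IsManifold 𝓘(ℝ, E) ((⊤ : ℕ∞) + 1) M := by
    simpa using (inferInstance : IsManifold 𝓘(ℝ, E) ∞ M)
  have : IsManifold 𝓘(ℝ, E) (minSmoothness ℝ 2) M := .of_le (n := ∞) (by simp [two_le_infty])
  exact hX.mlieBracket_vectorField (n := ⊤) (m := ⊤) hY (by simp)

theorem mlieBracket_leibniz {X Y Z : Π x : M, TangentSpace 𝓘(ℝ, E) x} {x : M}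
    (hZ : CMDiffAt ∞ (T% Z) x) (hX : CMDiffAt ∞ (T% X) x) (hY : CMDiffAt ∞ (T% Y) x) :
    mlieBracket 𝓘(ℝ, E) Z (mlieBracket 𝓘(ℝ, E) X Y) x =
      mlieBracket 𝓘(ℝ, E) (mlieBracket 𝓘(ℝ, E) Z X) Y x
        + mlieBracket 𝓘(ℝ, E) X (mlieBracket 𝓘(ℝ, E) Z Y) x := by
  have := FiniteDimensional.complete ℝ E
  have : IsManifold 𝓘(ℝ, E) (minSmoothness ℝ 3) M :=
    .of_le (n := ∞) (by rw [minSmoothness_of_isRCLikeNormedField]; exact WithTop.coe_le_coe.2 le_top)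
  have h2 : minSmoothness ℝ 2 ≤ ∞ := by simp [two_le_infty]
  exact leibniz_identity_mlieBracket_apply (hZ.of_le h2) (hX.of_le h2) (hY.of_le h2)

/-- The Lie bracket of two vector fields acts on functions as the commutator of the derivations.
This follows by comparing the coefficients of `Y` in the Jacobi identity for `Z`, `X`, `f • Y`. -/
theorem mvfderiv_mlieBracket {f : M → ℝ} {X Z : Π x : M, TangentSpace 𝓘(ℝ, E) x} {x : M}
    (hf : CMDiffAt ∞ f x) (hZ : CMDiffAt ∞ (T% Z) x) (hX : CMDiffAt ∞ (T% X) x) :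
    mvfderiv 𝓘(ℝ, E) f x (mlieBracket 𝓘(ℝ, E) Z X x) =
      mvfderiv 𝓘(ℝ, E) (fun y => mvfderiv 𝓘(ℝ, E) f y (X y)) x (Z x)
        - mvfderiv 𝓘(ℝ, E) (fun y => mvfderiv 𝓘(ℝ, E) f y (Z y)) x (X x) := by
  have := FiniteDimensional.complete ℝ E
  rcases subsingleton_or_nontrivial (TangentSpace 𝓘(ℝ, E) x) with hs | hs
  · simp [Subsingleton.elim (mlieBracket 𝓘(ℝ, E) Z X x) 0, Subsingleton.elim (X x) 0,
      Subsingleton.elim (Z x) 0]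
  obtain ⟨v, hv⟩ := exists_ne (0 : TangentSpace 𝓘(ℝ, E) x)
  set Y : Π x : M, TangentSpace 𝓘(ℝ, E) x := FiberBundle.extend E v
  have hY : CMDiffAt ∞ (T% Y) x := FiberBundle.contMDiffAt_extend ..
  have hYx : Y x = v := by simp [Y]
  have md {A : Π x : M, TangentSpace 𝓘(ℝ, E) x} (hA : CMDiffAt ∞ (T% A) x) :
      MDiffAt (T% A) x := hA.mdifferentiableAt (by simp)
  have mdf {a : M → ℝ} (ha : CMDiffAt ∞ a x) : MDiffAt a x := ha.mdifferentiableAt (by simp)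
  -- the expansion `[A, f Y] = (A f) Y + f [A, Y]`, valid near `x`
  have ev (A : Π x : M, TangentSpace 𝓘(ℝ, E) x) :
      mlieBracket 𝓘(ℝ, E) A (f • Y) =ᶠ[nhds x]
        (fun y => mvfderiv 𝓘(ℝ, E) f y (A y)) • Y + f • mlieBracket 𝓘(ℝ, E) A Y := by
    filter_upwards [eventually_mdifferentiableAt hf, eventually_mdifferentiableAt_section hY]
      with y hfy hYy
    exact mlieBracket_smul_right hfy hYy
  have jac := mlieBracket_leibniz hZ hX (hf.smul_section hY)
  have hXf := contMDiffAt_mvfderiv_apply hf hX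
  have hZf := contMDiffAt_mvfderiv_apply hf hZ
  have hZX := contMDiffAt_mlieBracket hZ hX
  have hXY := contMDiffAt_mlieBracket hX hY
  have hZY := contMDiffAt_mlieBracket hZ hY
  rw [Filter.EventuallyEq.mlieBracket_vectorField_eq (Filter.EventuallyEq.refl _ Z) (ev X),
    Filter.EventuallyEq.mlieBracket_vectorField_eq (Filter.EventuallyEq.refl _ X) (ev Z),
    mlieBracket_add_right (md (hXf.smul_section hY)) (md (hf.smul_section hXY)),
    mlieBracket_add_right (md (hZf.smul_section hY)) (md (hf.smul_section hZY)),
    mlieBracket_smul_right (mdf hXf) (md hY), mlieBracket_smul_right (mdf hZf) (md hY),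
    mlieBracket_smul_right (mdf hf) (md hXY), mlieBracket_smul_right (mdf hf) (md hZY),
    mlieBracket_smul_right (mdf hf) (md hY), mlieBracket_leibniz hZ hX hY, hYx] at jac
  have key : (mvfderiv 𝓘(ℝ, E) f x (mlieBracket 𝓘(ℝ, E) Z X x) -
      (mvfderiv 𝓘(ℝ, E) (fun y => mvfderiv 𝓘(ℝ, E) f y (X y)) x (Z x)
        - mvfderiv 𝓘(ℝ, E) (fun y => mvfderiv 𝓘(ℝ, E) f y (Z y)) x (X x))) • v = 0 := by
    linear_combination (norm := module) (-1 : ℝ) • jac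
  exact sub_eq_zero.1 ((smul_eq_zero.1 key).resolve_right hv)

end Derivations

/-! ### Lie derivatives of tensor fields along a vector field -/

section LieDerivatives

variable {E : Type*} [NormedAddCommGroup E] [NormedSpace ℝ E]
  {M : Type*} [TopologicalSpace M] [ChartedSpace E M] [IsManifold 𝓘(ℝ, E) ∞ M]

theorem OneForm.contMDiffAt_apply (α : OneForm E M) {X : Π x : M, TangentSpace 𝓘(ℝ, E) x} {x : M}
    (hX : CMDiffAt ∞ (T% X) x) : CMDiffAt ∞ (fun y => α y (X y)) x := by
  have h := ContMDiffAt.clm_bundle_apply (b := fun y : M => y)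
    (E₂ := Bundle.Trivial M ℝ) (F₂ := ℝ) (α.contMDiff.contMDiffAt (x := x)) hX
  rw [contMDiffAt_totalSpace] at h
  exact h.2

theorem EndField.contMDiffAt_apply (φ : EndField E M) {X : Π x : M, TangentSpace 𝓘(ℝ, E) x}
    {x : M} (hX : CMDiffAt ∞ (T% X) x) : CMDiffAt ∞ (T% fun y => φ y (X y)) x :=
  ContMDiffAt.clm_bundle_apply (b := fun y : M => y) (φ.contMDiff.contMDiffAt (x := x)) hX

theorem exists_contMDiffAt_extension (x : M) (v : TangentSpace 𝓘(ℝ, E) x) :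
    ∃ X : Π x : M, TangentSpace 𝓘(ℝ, E) x, CMDiffAt ∞ (T% X) x ∧ X x = v :=
  ⟨FiberBundle.extend E v, FiberBundle.contMDiffAt_extend .., by simp⟩

variable [FiniteDimensional ℝ E]

theorem dForm_swap (α : OneForm E M) (x : M) (v w : TangentSpace 𝓘(ℝ, E) x) :
    dForm α x v w = -dForm α x w v := by
  have h := dForm_self α x (v + w)
  simp only [map_add, _root_.add_apply, dForm_self] at h
  linarith

theorem dForm_eventuallyEq (α : OneForm E M) {X Y : Π x : M, TangentSpace 𝓘(ℝ, E) x} {x : M}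
    (hX : CMDiffAt ∞ (T% X) x) (hY : CMDiffAt ∞ (T% Y) x) :
    (fun y => dForm α y (X y) (Y y)) =ᶠ[nhds x] fun y =>
      (1 / 2 : ℝ) * (mvfderiv 𝓘(ℝ, E) (fun y => α y (Y y)) y (X y)
        - mvfderiv 𝓘(ℝ, E) (fun y => α y (X y)) y (Y y)
        - α y (mlieBracket 𝓘(ℝ, E) X Y y)) := by
  filter_upwards [eventually_mdifferentiableAt_section hX,
    eventually_mdifferentiableAt_section hY] with y hXy hYy
  exact dForm_apply α hXy hYy

theorem contMDiffAt_dForm_apply (α : OneForm E M) {X Y : Π x : M, TangentSpace 𝓘(ℝ, E) x} {x : M}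
    (hX : CMDiffAt ∞ (T% X) x) (hY : CMDiffAt ∞ (T% Y) x) :
    CMDiffAt ∞ (fun y => dForm α y (X y) (Y y)) x := by
  refine ContMDiffAt.congr_of_eventuallyEq ?_ (dForm_eventuallyEq α hX hY)
  exact contMDiffAt_const.mul
    (((contMDiffAt_mvfderiv_apply (α.contMDiffAt_apply hY) hX).sub
      (contMDiffAt_mvfderiv_apply (α.contMDiffAt_apply hX) hY)).sub
      (α.contMDiffAt_apply (contMDiffAt_mlieBracket hX hY)))

/-- If `α(Z)` is constant and `i_Z dα = 0`, then `𝓛_Z α = 0`. -/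
theorem mvfderiv_oneForm_apply (α : OneForm E M) (Z : VField E M) {c : ℝ}
    (hc : ∀ x, α x (Z x) = c) (hd : ∀ x v, dForm α x (Z x) v = 0)
    {X : Π x : M, TangentSpace 𝓘(ℝ, E) x} {x : M} (hX : MDiffAt (T% X) x) :
    mvfderiv 𝓘(ℝ, E) (fun y => α y (X y)) x (Z x) =
      α x (mlieBracket 𝓘(ℝ, E) (fun y => Z y) X x) := by
  have h := dForm_apply α (Z.mdiffAt x) hX
  simp only [hd, hc, mvfderiv_const, _root_.zero_apply] at h
  linarith

/-- If `α(Z)` is constant and `i_Z dα = 0`, then `𝓛_Z dα = 0`. -/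
theorem mvfderiv_dForm_apply (α : OneForm E M) (Z : VField E M) {c : ℝ}
    (hc : ∀ x, α x (Z x) = c) (hd : ∀ x v, dForm α x (Z x) v = 0)
    {X Y : Π x : M, TangentSpace 𝓘(ℝ, E) x} {x : M}
    (hX : CMDiffAt ∞ (T% X) x) (hY : CMDiffAt ∞ (T% Y) x) :
    mvfderiv 𝓘(ℝ, E) (fun y => dForm α y (X y) (Y y)) x (Z x) =
      dForm α x (mlieBracket 𝓘(ℝ, E) (fun y => Z y) X x) (Y x)
        + dForm α x (X x) (mlieBracket 𝓘(ℝ, E) (fun y => Z y) Y x) := by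
  have hZ : CMDiffAt ∞ (T% fun y => Z y) x := Z.contMDiff.contMDiffAt
  have md {A : Π x : M, TangentSpace 𝓘(ℝ, E) x} (hA : CMDiffAt ∞ (T% A) x) :
      MDiffAt (T% A) x := hA.mdifferentiableAt (by simp)
  have mdf {a : M → ℝ} (ha : CMDiffAt ∞ a x) : MDiffAt a x := ha.mdifferentiableAt (by simp)
  have hXY := contMDiffAt_mlieBracket hX hY
  have hZX := contMDiffAt_mlieBracket hZ hX
  have hZY := contMDiffAt_mlieBracket hZ hY
  have hαX := α.contMDiffAt_apply hX
  have hαY := α.contMDiffAt_apply hY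
  have h1 := contMDiffAt_mvfderiv_apply hαY hX
  have h2 := contMDiffAt_mvfderiv_apply hαX hY
  have h3 := α.contMDiffAt_apply hXY
  -- `Z(α(A)) = α([Z, A])` holds near `x` and may be differentiated
  have ev {A : Π x : M, TangentSpace 𝓘(ℝ, E) x} (hA : CMDiffAt ∞ (T% A) x) :
      (fun y => mvfderiv 𝓘(ℝ, E) (fun y => α y (A y)) y (Z y)) =ᶠ[nhds x]
        fun y => α y (mlieBracket 𝓘(ℝ, E) (fun y => Z y) A y) := by
    filter_upwards [eventually_mdifferentiableAt_section hA] with y hAy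
    exact mvfderiv_oneForm_apply α Z hc hd hAy
  have cX := mvfderiv_mlieBracket hαX hZ hY
  have cY := mvfderiv_mlieBracket hαY hZ hX
  rw [mvfderiv_congr_of_eventuallyEq (ev hX)] at cX
  rw [mvfderiv_congr_of_eventuallyEq (ev hY)] at cY
  rw [mvfderiv_congr_of_eventuallyEq (dForm_eventuallyEq α hX hY),
    mvfderiv_fun_mul (mdf contMDiffAt_const) (mdf ((h1.sub h2).sub h3)),
    mvfderiv_fun_sub (mdf (h1.sub h2)) (mdf h3), mvfderiv_fun_sub (mdf h1) (mdf h2),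
    mvfderiv_const, dForm_apply α (md hZX) (md hY), dForm_apply α (md hX) (md hZY)]
  have h4 := mvfderiv_oneForm_apply α Z hc hd (md hXY)
  rw [mlieBracket_leibniz hZ hX hY, map_add] at h4
  simp only [smul_zero, add_zero, _root_.smul_apply, _root_.sub_apply, h4, smul_eq_mul]
  linarith

end LieDerivatives

/-! ### Lie derivatives along combinations of the Reeb vector fields -/

section Reeb

variable {E : Type*} [NormedAddCommGroup E] [NormedSpace ℝ E] [FiniteDimensional ℝ E]
  {M : Type*} [TopologicalSpace M] [ChartedSpace E M] [IsManifold 𝓘(ℝ, E) ∞ M]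

/-- `Z` behaves like the combination `c₁ Z₁ + c₂ Z₂` of the Reeb vector fields: `αᵢ(Z) = cᵢ`,
`i_Z dαᵢ = 0` and `φ Z = 0`. -/
structure IsReebCombination (α₁ α₂ : OneForm E M) (φ : EndField E M) (Z : VField E M)
    (c₁ c₂ : ℝ) : Prop where
  apply₁ : ∀ x, α₁ x (Z x) = c₁
  apply₂ : ∀ x, α₂ x (Z x) = c₂
  d_apply₁ : ∀ x v, dForm α₁ x (Z x) v = 0
  d_apply₂ : ∀ x v, dForm α₂ x (Z x) v = 0
  apply_end : ∀ x, φ x (Z x) = 0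

variable {p q : ℕ} {α₁ α₂ : OneForm E M} {Z₁ Z₂ Z : VField E M} {φ : EndField E M}
  {g : Metric E M} {c₁ c₂ : ℝ}

theorem IsMCP.isReebCombination₁ (H : IsMCP p q α₁ α₂ Z₁ Z₂ φ g) :
    IsReebCombination α₁ α₂ φ Z₁ 1 0 :=
  ⟨H.1.2.1, H.1.2.4, H.1.2.5, H.1.2.6, H.1.4⟩

theorem IsMCP.isReebCombination₂ (H : IsMCP p q α₁ α₂ Z₁ Z₂ φ g) :
    IsReebCombination α₁ α₂ φ Z₂ 0 1 :=
  ⟨H.1.2.3, H.1.2.2, H.1.2.7, H.1.2.8, H.1.5⟩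

theorem IsMCP.isReebCombination_add (H : IsMCP p q α₁ α₂ Z₁ Z₂ φ g) :
    IsReebCombination α₁ α₂ φ (Z₁ + Z₂) 1 1 where
  apply₁ x := by simp [H.1.2.1, H.1.2.3]
  apply₂ x := by simp [H.1.2.2, H.1.2.4]
  d_apply₁ x v := by simp [H.1.2.5, H.1.2.7]
  d_apply₂ x v := by simp [H.1.2.6, H.1.2.8]
  apply_end x := by simp [H.1.4, H.1.5]

theorem IsMCP.inner_apply_swap (H : IsMCP p q α₁ α₂ Z₁ Z₂ φ g) (x : M)
    (v w : TangentSpace 𝓘(ℝ, E) x) : g.inner x (φ x v) w = -g.inner x v (φ x w) := by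
  rw [g.symm, H.inner_apply, H.inner_apply, dForm_swap α₁ x w, dForm_swap α₂ x w]
  ring

theorem IsMCP.oneForm₁_apply_end (H : IsMCP p q α₁ α₂ Z₁ Z₂ φ g) (x : M)
    (v : TangentSpace 𝓘(ℝ, E) x) : α₁ x (φ x v) = 0 := by
  rw [← H.inner_reeb₁, H.inner_apply_swap, H.1.4]
  simp

theorem IsMCP.oneForm₂_apply_end (H : IsMCP p q α₁ α₂ Z₁ Z₂ φ g) (x : M)
    (v : TangentSpace 𝓘(ℝ, E) x) : α₂ x (φ x v) = 0 := by
  rw [← H.inner_reeb₂, H.inner_apply_swap, H.1.5]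
  simp

theorem IsMCP.sq_apply_of_eq_zero (H : IsMCP p q α₁ α₂ Z₁ Z₂ φ g) {x : M}
    {v : TangentSpace 𝓘(ℝ, E) x} (h₁ : α₁ x v = 0) (h₂ : α₂ x v = 0) : φ x (φ x v) = -v := by
  simp [H.1.3, h₁, h₂]

theorem IsMCP.inner_sq_apply (H : IsMCP p q α₁ α₂ Z₁ Z₂ φ g) (x : M)
    (v w : TangentSpace 𝓘(ℝ, E) x) :
    g.inner x v (φ x (φ x w)) = -g.inner x v w + α₁ x v * α₁ x w + α₂ x v * α₂ x w := by
  simp [H.1.3, H.inner_reeb₁, H.inner_reeb₂]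
  ring

/-- `dα₁ + dα₂` is nondegenerate on `ker α₁ ∩ ker α₂`. -/
theorem IsMCP.eq_zero_of_dForm_eq_zero (H : IsMCP p q α₁ α₂ Z₁ Z₂ φ g) {x : M}
    {v : TangentSpace 𝓘(ℝ, E) x} (h₁ : α₁ x v = 0) (h₂ : α₂ x v = 0)
    (hd : ∀ w, dForm α₁ x v w + dForm α₂ x v w = 0) : v = 0 := by
  by_contra hv
  have h := H.inner_sq_apply x v v
  rw [H.inner_apply, hd, h₁, h₂] at h
  have := g.pos x v hv
  linarith

/-- `[Z, W] = 0`: the forms `α₁`, `α₂` and `dα₁ + dα₂` all vanish on this bracket. -/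
theorem IsMCP.mlieBracket_eq_zero (H : IsMCP p q α₁ α₂ Z₁ Z₂ φ g)
    (hZ : IsReebCombination α₁ α₂ φ Z c₁ c₂) {W : VField E M} {d₁ d₂ : ℝ}
    (hW : IsReebCombination α₁ α₂ φ W d₁ d₂) (x : M) :
    mlieBracket 𝓘(ℝ, E) (fun y => Z y) (fun y => W y) x = 0 := by
  refine H.eq_zero_of_dForm_eq_zero (x := x) ?_ ?_ fun w => ?_
  · rw [← mvfderiv_oneForm_apply α₁ Z hZ.apply₁ hZ.d_apply₁ (W.mdiffAt x)]
    simp [hW.apply₁, mvfderiv_const]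
  · rw [← mvfderiv_oneForm_apply α₂ Z hZ.apply₂ hZ.d_apply₂ (W.mdiffAt x)]
    simp [hW.apply₂, mvfderiv_const]
  · obtain ⟨Y, hY, rfl⟩ := exists_contMDiffAt_extension x w
    have h₁ := mvfderiv_dForm_apply α₁ Z hZ.apply₁ hZ.d_apply₁ (x := x) W.contMDiff.contMDiffAt hY
    have h₂ := mvfderiv_dForm_apply α₂ Z hZ.apply₂ hZ.d_apply₂ (x := x) W.contMDiff.contMDiffAt hY
    simp only [hW.d_apply₁, hW.d_apply₂, mvfderiv_const, _root_.zero_apply, add_zero] at h₁ h₂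
    rw [← h₁, ← h₂, add_zero]

/-- The Leibniz rule `[Z, φ X] = (𝓛_Z φ) X + φ [Z, X]`. -/
theorem mlieBracket_endField_apply (φ : EndField E M) (Z : VField E M)
    {X : Π x : M, TangentSpace 𝓘(ℝ, E) x} {x : M} (hX : MDiffAt (T% X) x) :
    mlieBracket 𝓘(ℝ, E) (fun y => Z y) (fun y => φ y (X y)) x =
      lieDeriv Z φ x (X x) + φ x (mlieBracket 𝓘(ℝ, E) (fun y => Z y) X x) := by
  rw [lieDeriv_apply Z φ hX, sub_add_cancel]

theorem IsMCP.oneForm₁_lieDeriv (H : IsMCP p q α₁ α₂ Z₁ Z₂ φ g)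
    (hZ : IsReebCombination α₁ α₂ φ Z c₁ c₂) (x : M) (v : TangentSpace 𝓘(ℝ, E) x) :
    α₁ x (lieDeriv Z φ x v) = 0 := by
  obtain ⟨X, hX, rfl⟩ := exists_contMDiffAt_extension x v
  have hX' := hX.mdifferentiableAt (by simp)
  rw [lieDeriv_apply Z φ hX', map_sub, H.oneForm₁_apply_end,
    ← mvfderiv_oneForm_apply α₁ Z hZ.apply₁ hZ.d_apply₁ (φ.mdiffAt_apply hX')]
  simp [H.oneForm₁_apply_end, mvfderiv_const]

theorem IsMCP.oneForm₂_lieDeriv (H : IsMCP p q α₁ α₂ Z₁ Z₂ φ g)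
    (hZ : IsReebCombination α₁ α₂ φ Z c₁ c₂) (x : M) (v : TangentSpace 𝓘(ℝ, E) x) :
    α₂ x (lieDeriv Z φ x v) = 0 := by
  obtain ⟨X, hX, rfl⟩ := exists_contMDiffAt_extension x v
  have hX' := hX.mdifferentiableAt (by simp)
  rw [lieDeriv_apply Z φ hX', map_sub, H.oneForm₂_apply_end,
    ← mvfderiv_oneForm_apply α₂ Z hZ.apply₂ hZ.d_apply₂ (φ.mdiffAt_apply hX')]
  simp [H.oneForm₂_apply_end, mvfderiv_const]

/-- `𝓛_Z φ` anticommutes with `φ`: this is `𝓛_Z` applied to the formula for `φ²`, whose right-hand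
side is built from the `Z`-invariant tensors `Id`, `αᵢ` and `Zᵢ`. -/
theorem IsMCP.lieDeriv_anticomm (H : IsMCP p q α₁ α₂ Z₁ Z₂ φ g)
    (hZ : IsReebCombination α₁ α₂ φ Z c₁ c₂) (x : M) (v : TangentSpace 𝓘(ℝ, E) x) :
    lieDeriv Z φ x (φ x v) + φ x (lieDeriv Z φ x v) = 0 := by
  have := FiniteDimensional.complete ℝ E
  obtain ⟨X, hX, rfl⟩ := exists_contMDiffAt_extension x v
  have hX' := hX.mdifferentiableAt (by simp)
  have hα₁ := α₁.mdiffAt_apply hX'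
  have hα₂ := α₂.mdiffAt_apply hX'
  have e : (fun y => φ y (φ y (X y))) = ((-1 : ℝ) • X + (fun y => α₁ y (X y)) • fun y => Z₁ y)
      + (fun y => α₂ y (X y)) • fun y => Z₂ y := by
    ext1 y
    simp [H.1.3]
  have hs₁ := hα₁.smul_section (Z₁.mdiffAt x)
  have hs₂ := hα₂.smul_section (Z₂.mdiffAt x)
  have hneg : MDiffAt (T% ((-1 : ℝ) • X)) x :=
    hX.const_smul_section.mdifferentiableAt (by simp)
  have h := lieDeriv_apply Z φ (φ.mdiffAt_apply hX')
  rw [e, mlieBracket_add_right (mdifferentiableAt_add_section hneg hs₁) hs₂,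
    mlieBracket_add_right hneg hs₁, mlieBracket_smul_right hα₁ (Z₁.mdiffAt x),
    mlieBracket_smul_right hα₂ (Z₂.mdiffAt x), mlieBracket_const_smul_right hX',
    H.mlieBracket_eq_zero hZ H.isReebCombination₁, H.mlieBracket_eq_zero hZ H.isReebCombination₂,
    mvfderiv_oneForm_apply α₁ Z hZ.apply₁ hZ.d_apply₁ hX',
    mvfderiv_oneForm_apply α₂ Z hZ.apply₂ hZ.d_apply₂ hX'] at h
  rw [h, lieDeriv_apply Z φ hX', map_sub, H.1.3 x (mlieBracket _ _ _ x)]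
  module

/-- `(𝓛_Z g)(X, W) = -g(X, φ (𝓛_Z φ) W)`: differentiate
`g(X, W) = -(dα₁ + dα₂)(X, φ W) + α₁(X) α₁(W) + α₂(X) α₂(W)` along `Z`. -/
theorem IsMCP.mvfderiv_inner (H : IsMCP p q α₁ α₂ Z₁ Z₂ φ g)
    (hZ : IsReebCombination α₁ α₂ φ Z c₁ c₂) {X W : Π x : M, TangentSpace 𝓘(ℝ, E) x} {x : M}
    (hX : CMDiffAt ∞ (T% X) x) (hW : CMDiffAt ∞ (T% W) x) :
    mvfderiv 𝓘(ℝ, E) (fun y => g.inner y (X y) (W y)) x (Z x) =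
      g.inner x (mlieBracket 𝓘(ℝ, E) (fun y => Z y) X x) (W x)
        + g.inner x (X x) (mlieBracket 𝓘(ℝ, E) (fun y => Z y) W x)
        - g.inner x (X x) (φ x (lieDeriv Z φ x (W x))) := by
  have hX' := hX.mdifferentiableAt (by simp)
  have hW' := hW.mdifferentiableAt (by simp)
  have mdf {a : M → ℝ} (ha : CMDiffAt ∞ a x) : MDiffAt a x := ha.mdifferentiableAt (by simp)
  have hφW := φ.contMDiffAt_apply hW
  have e : (fun y => g.inner y (X y) (W y)) = fun y =>
      ((α₁ y (X y) * α₁ y (W y) + α₂ y (X y) * α₂ y (W y)) -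
        dForm α₁ y (X y) (φ y (W y))) - dForm α₂ y (X y) (φ y (W y)) := by
    ext1 y
    have := H.inner_sq_apply y (X y) (W y)
    rw [H.inner_apply] at this
    linarith
  have h1 := contMDiffAt_dForm_apply α₁ hX hφW
  have h2 := contMDiffAt_dForm_apply α₂ hX hφW
  have a1 := α₁.contMDiffAt_apply hX
  have a2 := α₂.contMDiffAt_apply hX
  have b1 := α₁.contMDiffAt_apply hW
  have b2 := α₂.contMDiffAt_apply hW
  have s1 := H.inner_sq_apply x (mlieBracket 𝓘(ℝ, E) (fun y => Z y) X x) (W x)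
  have s2 := H.inner_sq_apply x (X x) (mlieBracket 𝓘(ℝ, E) (fun y => Z y) W x)
  rw [H.inner_apply] at s1 s2
  have m1 : CMDiffAt ∞ (fun y => α₁ y (X y) * α₁ y (W y)) x := a1.mul b1
  have m2 : CMDiffAt ∞ (fun y => α₂ y (X y) * α₂ y (W y)) x := a2.mul b2
  have m3 : CMDiffAt ∞ (fun y => α₁ y (X y) * α₁ y (W y) + α₂ y (X y) * α₂ y (W y)) x := m1.add m2
  rw [e, mvfderiv_fun_sub (mdf (m3.sub h1)) (mdf h2), mvfderiv_fun_sub (mdf m3) (mdf h1),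
    mvfderiv_fun_add (mdf m1) (mdf m2),
    mvfderiv_fun_mul (mdf a1) (mdf b1), mvfderiv_fun_mul (mdf a2) (mdf b2)]
  simp only [_root_.sub_apply, _root_.add_apply, _root_.smul_apply, smul_eq_mul,
    mvfderiv_oneForm_apply α₁ Z hZ.apply₁ hZ.d_apply₁ hX',
    mvfderiv_oneForm_apply α₂ Z hZ.apply₂ hZ.d_apply₂ hX',
    mvfderiv_oneForm_apply α₁ Z hZ.apply₁ hZ.d_apply₁ hW',
    mvfderiv_oneForm_apply α₂ Z hZ.apply₂ hZ.d_apply₂ hW',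
    mvfderiv_dForm_apply α₁ Z hZ.apply₁ hZ.d_apply₁ hX hφW,
    mvfderiv_dForm_apply α₂ Z hZ.apply₂ hZ.d_apply₂ hX hφW,
    mlieBracket_endField_apply φ Z hW', map_add]
  rw [H.inner_apply]
  linarith

/-- `φ ∘ 𝓛_Z φ` is symmetric, since `𝓛_Z g` is. -/
theorem IsMCP.inner_end_lieDeriv_comm (H : IsMCP p q α₁ α₂ Z₁ Z₂ φ g)
    (hZ : IsReebCombination α₁ α₂ φ Z c₁ c₂) (x : M) (v w : TangentSpace 𝓘(ℝ, E) x) :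
    g.inner x v (φ x (lieDeriv Z φ x w)) = g.inner x w (φ x (lieDeriv Z φ x v)) := by
  obtain ⟨X, hX, rfl⟩ := exists_contMDiffAt_extension x v
  obtain ⟨W, hW, rfl⟩ := exists_contMDiffAt_extension x w
  have h1 := H.mvfderiv_inner hZ hX hW
  have h2 := H.mvfderiv_inner hZ hW hX
  have e : (fun y => g.inner y (W y) (X y)) = fun y => g.inner y (X y) (W y) := by
    ext y; exact g.symm y _ _
  rw [e, h1, g.symm x _ (W x), g.symm x (X x) (mlieBracket _ _ _ _)] at h2
  linarith

theorem IsMCP.isSymmetricField_lieDeriv (H : IsMCP p q α₁ α₂ Z₁ Z₂ φ g)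
    (hZ : IsReebCombination α₁ α₂ φ Z c₁ c₂) : IsSymmetricField g (lieDeriv Z φ) := by
  intro x v w
  have hA (u : TangentSpace 𝓘(ℝ, E) x) : φ x (φ x (lieDeriv Z φ x u)) = -lieDeriv Z φ x u :=
    H.sq_apply_of_eq_zero (H.oneForm₁_lieDeriv hZ x u) (H.oneForm₂_lieDeriv hZ x u)
  have h := H.inner_end_lieDeriv_comm hZ x v (φ x w)
  rw [eq_neg_of_add_eq_zero_left (H.lieDeriv_anticomm hZ x w), map_neg, hA, neg_neg,
    H.inner_apply_swap, hA, map_neg, neg_neg, g.symm] at h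
  rw [g.symm x v, h, g.symm]

/-- `∇_X Z = -φ X - φ h X` for `Z = Z₁ + Z₂`. In the Koszul formula for `2 g(∇_X Z, W)` the terms
containing `g(Z, ·) = α₁ + α₂` add up to `2 (dα₁ + dα₂)(X, W)`, the others to `(𝓛_Z g)(X, W)`. -/
theorem IsMCP.leviCivita_reeb (H : IsMCP p q α₁ α₂ Z₁ Z₂ φ g) (x : M)
    (v : TangentSpace 𝓘(ℝ, E) x) :
    leviCivita g (fun y => (Z₁ + Z₂) y) x v = -φ x v - φ x (hTensor Z₁ Z₂ φ x v) := by
  rw [← sub_eq_zero]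
  refine g.eq_zero x _ fun w => ?_
  obtain ⟨X, hX, rfl⟩ := exists_contMDiffAt_extension x v
  obtain ⟨W, hW, rfl⟩ := exists_contMDiffAt_extension x w
  have hX' := hX.mdifferentiableAt (by simp)
  have hW' := hW.mdifferentiableAt (by simp)
  have hZ := H.isReebCombination_add
  have k := inner_leviCivitaFun g hX' ((Z₁ + Z₂).mdiffAt x) hW'
  have iZ (y : M) (u : TangentSpace 𝓘(ℝ, E) y) :
      g.inner y u ((Z₁ + Z₂) y) = α₁ y u + α₂ y u := by
    simp [H.inner_reeb₁, H.inner_reeb₂]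
  have iZ' (y : M) (u : TangentSpace 𝓘(ℝ, E) y) :
      g.inner y ((Z₁ + Z₂) y) u = α₁ y u + α₂ y u := by
    rw [g.symm, iZ]
  have d₁ := dForm_apply α₁ hX' hW'
  have d₂ := dForm_apply α₂ hX' hW'
  have hs : g.inner x (φ x (lieDeriv (Z₁ + Z₂) φ x (X x))) (W x) =
      g.inner x (X x) (φ x (lieDeriv (Z₁ + Z₂) φ x (W x))) := by
    rw [g.symm, H.inner_end_lieDeriv_comm hZ]
  simp only [koszul, iZ, iZ', H.mvfderiv_inner hZ hX hW,
    mvfderiv_fun_add (α₁.mdiffAt_apply hX') (α₂.mdiffAt_apply hX'),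
    mvfderiv_fun_add (α₁.mdiffAt_apply hW') (α₂.mdiffAt_apply hW'), _root_.add_apply] at k
  rw [mlieBracket_swap_apply (V := X) (W := fun y => (Z₁ + Z₂) y),
    g.symm x (mlieBracket _ _ W x) (X x)] at k
  change g.inner x (leviCivitaFun g (fun y => (Z₁ + Z₂) y) x (X x) - _) (W x) = 0
  simp only [map_sub, map_neg, _root_.sub_apply, _root_.neg_apply, k, H.inner_apply_swap x (X x),
    hTensor, _root_.smul_apply, map_smul, smul_eq_mul, hs, H.inner_apply x (X x) (W x), d₁, d₂]
  ring

end Reeb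

/-! ### Wedge powers of two-forms and their rank -/

section WedgeRank

theorem alternatization_domDomCongr {V N ι ι' : Type*} [AddCommGroup V] [Module ℝ V]
    [AddCommGroup N] [Module ℝ N] [Fintype ι] [DecidableEq ι] [Fintype ι'] [DecidableEq ι']
    (e : ι ≃ ι') (m : MultilinearMap ℝ (fun _ : ι => V) N) :
    MultilinearMap.alternatization (m.domDomCongr e) =
      (MultilinearMap.alternatization m).domDomCongr e := by
  ext v
  simp only [MultilinearMap.alternatization_apply, AlternatingMap.domDomCongr_apply]
  refine (Fintype.sum_equiv e.permCongr _ _ fun σ => ?_).symm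
  simp [Function.comp_def]

variable {V : Type*} [AddCommGroup V] [Module ℝ V]

/-- The multilinear map `(v₀, v₁, …) ↦ w(v₀, v₁) w(v₂, v₃) ⋯` with `k` factors. -/
def prodPairs (w : V [⋀^Fin 2]→ₗ[ℝ] ℝ) : (k : ℕ) → MultilinearMap ℝ (fun _ : Fin (2 * k) => V) ℝ
  | 0 => MultilinearMap.constOfIsEmpty ℝ (fun _ : Fin 0 => V) 1
  | k + 1 => ((LinearMap.mul' ℝ ℝ).compMultilinearMap
      ((prodPairs w k).domCoprod (w : MultilinearMap ℝ (fun _ : Fin 2 => V) ℝ))).domDomCongr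
        finSumFinEquiv

theorem prodPairs_apply (w : V [⋀^Fin 2]→ₗ[ℝ] ℝ) (k : ℕ) (v : Fin (2 * k) → V) :
    prodPairs w k v = ∏ i : Fin k, w ![v ⟨2 * i, by omega⟩, v ⟨2 * i + 1, by omega⟩] := by
  induction k with
  | zero => simp [prodPairs]
  | succ k ih =>
    rw [Fin.prod_univ_castSucc, prodPairs]
    simp only [MultilinearMap.domDomCongr_apply, LinearMap.compMultilinearMap_apply,
      MultilinearMap.domCoprod_apply, LinearMap.mul'_apply, ih]
    congr 1
    change w _ = w _
    congr 1
    ext i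
    fin_cases i <;> rfl

/-- The factor `2 ^ k` comes from the `2!` terms in the alternatization of each factor `w`. -/
theorem alternatization_prodPairs (w : V [⋀^Fin 2]→ₗ[ℝ] ℝ) (k : ℕ) :
    MultilinearMap.alternatization (prodPairs w k) = (2 : ℝ) ^ k • wedgePow w k := by
  induction k with
  | zero =>
    ext v
    simp [prodPairs, wedgePow, MultilinearMap.alternatization_apply]
  | succ k ih =>
    rw [prodPairs, alternatization_domDomCongr, LinearMap.compMultilinearMap_alternatization,
      MultilinearMap.domCoprod_alternization, ih, AlternatingMap.coe_alternatization]
    rw [← AlternatingMap.domCoprod'_apply, wedgePow, wedge, ← AlternatingMap.domCoprod'_apply]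
    ext v
    simp [← TensorProduct.smul_tmul', pow_succ]
    ring

/-- The coefficient of `(i, s)`, `(j, t)` in the standard symplectic matrix, where `(i, false)`
and `(i, true)` index the two vectors of the `i`-th pair. -/
def symplecticCoeff {ι : Type*} [DecidableEq ι] (a b : ι × Bool) : ℤ :=
  if a.1 = b.1 then (if b.2 then 1 else 0) - (if a.2 then 1 else 0) else 0

/-- Every term of the expansion of the top power of the standard symplectic form is nonnegative:
a permutation with nonzero term permutes the pairs and then acts within each pair, so its sign is
the product of the signs of the latter actions. -/
theorem sign_mul_prod_symplecticCoeff_nonneg {ι : Type*} [DecidableEq ι] [Fintype ι]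
    (σ : Equiv.Perm (ι × Bool)) :
    0 ≤ (Equiv.Perm.sign σ : ℤ) * ∏ i, symplecticCoeff (σ (i, false)) (σ (i, true)) := by
  by_cases h : ∀ i, (σ (i, false)).1 = (σ (i, true)).1
  swap
  · push Not at h
    obtain ⟨i, hi⟩ := h
    rw [Finset.prod_eq_zero (Finset.mem_univ i) (by simp [symplecticCoeff, hi]), mul_zero]
  have h' (i : ι) (s : Bool) : (σ (i, s)).1 = (σ (i, false)).1 := by
    cases s
    · rfl
    · exact (h i).symm
  have hsurj : Function.Surjective fun i => (σ (i, false)).1 := fun j =>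
    ⟨(σ.symm (j, false)).1, by
      have := h' (σ.symm (j, false)).1 (σ.symm (j, false)).2
      simpa using this.symm⟩
  let τ : Equiv.Perm ι := Equiv.ofBijective _ (Finite.surjective_iff_bijective.1 hsurj)
  have hinj (i : ι) : Function.Injective fun s => (σ (i, s)).2 := fun s t hst => by
    have := σ.injective (Prod.ext ((h' i s).trans (h' i t).symm) hst)
    exact congrArg Prod.snd this
  let ρ : ι → Equiv.Perm Bool := fun i =>
    Equiv.ofBijective _ (Finite.injective_iff_bijective.1 (hinj i))
  have hσ : σ = Equiv.prodCongrLeft (fun _ : Bool => τ) * Equiv.prodCongrRight ρ := by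
    ext ⟨i, s⟩ : 1
    exact Prod.ext (h' i s) rfl
  have hsign : (Equiv.Perm.sign σ : ℤ) = ∏ i, (Equiv.Perm.sign (ρ i) : ℤ) := by
    rw [hσ, Equiv.Perm.sign_mul, Equiv.Perm.sign_prodCongrLeft, Equiv.Perm.sign_prodCongrRight]
    simp
  have hone : ∀ r : Equiv.Perm Bool, (Equiv.Perm.sign r : ℤ) *
      ((if r true then 1 else 0) - (if r false then 1 else 0)) = 1 := by
    decide
  rw [hsign, ← Finset.prod_mul_distrib]
  refine Finset.prod_nonneg fun i _ => ?_
  have hi : symplecticCoeff (σ (i, false)) (σ (i, true)) =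
      (if ρ i true then 1 else 0) - (if ρ i false then 1 else 0) := by
    simp [symplecticCoeff, h i, ρ]
  rw [hi, hone]
  exact zero_le_one

/-- The positions `2 i`, `2 i + 1` as the two members of the `i`-th pair. -/
def pairEquiv (k : ℕ) : Fin (2 * k) ≃ Fin k × Bool where
  toFun a := (⟨a / 2, by omega⟩, decide (a.1 % 2 = 1))
  invFun a := ⟨2 * a.1 + (if a.2 then 1 else 0), by split <;> omega⟩
  left_inv a := by
    ext
    rcases Nat.mod_two_eq_zero_or_one a with h | h <;> simp [h] <;> omega
  right_inv a := by
    rcases a with ⟨i, s⟩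
    cases s <;> ext <;> simp
    omega

theorem pairEquiv_symm_false {k : ℕ} (i : Fin k) :
    (pairEquiv k).symm (i, false) = ⟨2 * i, by omega⟩ := rfl

theorem pairEquiv_symm_true {k : ℕ} (i : Fin k) :
    (pairEquiv k).symm (i, true) = ⟨2 * i + 1, by omega⟩ := rfl

/-- A two-form has nonzero `k`-th power if it admits a symplectic family of `k` pairs. -/
theorem wedgePow_ne_zero_of_symplectic {k : ℕ} (w : V [⋀^Fin 2]→ₗ[ℝ] ℝ) (u : Fin k × Bool → V)
    (hu : ∀ a b, w ![u a, u b] = symplecticCoeff a b) : wedgePow w k ≠ 0 := by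
  intro h0
  have h := congrArg (fun A => A (u ∘ pairEquiv k)) (alternatization_prodPairs w k)
  simp only [h0, smul_zero, AlternatingMap.zero_apply, MultilinearMap.alternatization_apply] at h
  have hterm (σ : Equiv.Perm (Fin k × Bool)) :
      Equiv.Perm.sign ((pairEquiv k).symm.permCongr σ) •
        ((prodPairs w k).domDomCongr ((pairEquiv k).symm.permCongr σ)) (u ∘ pairEquiv k) =
      (((Equiv.Perm.sign σ : ℤ) *
        ∏ i, symplecticCoeff (σ (i, false)) (σ (i, true)) : ℤ) : ℝ) := by
    rw [MultilinearMap.domDomCongr_apply, prodPairs_apply]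
    simp only [← pairEquiv_symm_false, ← pairEquiv_symm_true, Function.comp_apply,
      Equiv.permCongr_apply, Equiv.symm_symm, Equiv.apply_symm_apply, hu,
      Equiv.Perm.sign_permCongr]
    simp [Units.smul_def]
  rw [← Fintype.sum_equiv (pairEquiv k).symm.permCongr _ _ fun σ => (hterm σ).symm,
    ← Int.cast_sum, Int.cast_eq_zero,
    Finset.sum_eq_zero_iff_of_nonneg fun σ _ => sign_mul_prod_symplecticCoeff_nonneg σ] at h
  have := h 1 (Finset.mem_univ _)
  simp [symplecticCoeff] at this

variable [FiniteDimensional ℝ V]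

/-- A skew form of rank greater than `2 (k - 1)` admits a symplectic family of `k` pairs. -/
theorem exists_symplectic_family (b : V →ₗ[ℝ] V →ₗ[ℝ] ℝ) (hb : ∀ v, b v v = 0) (k : ℕ)
    (hk : finrank ℝ (LinearMap.ker b) + 2 * k < finrank ℝ V + 2) :
    ∃ e f : ℕ → V, ∀ i < k, ∀ j < k, b (e i) (e j) = 0 ∧ b (f i) (f j) = 0 ∧
      b (e i) (f j) = if i = j then 1 else 0 := by
  have skew (v w : V) : b v w = -b w v := by
    have h := hb (v + w)
    simp only [map_add, LinearMap.add_apply, hb] at h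
    linarith
  induction k with
  | zero => exact ⟨0, 0, by simp⟩
  | succ k ih =>
    obtain ⟨e, f, hef⟩ := ih (by omega)
    -- the vectors orthogonal to the pairs found so far are too many to lie in the kernel
    let L : V →ₗ[ℝ] (Fin k → ℝ) × (Fin k → ℝ) :=
      (LinearMap.pi fun i : Fin k => b (e i)).prod (LinearMap.pi fun i : Fin k => b (f i))
    have hL := L.finrank_range_add_finrank_ker
    have hr : finrank ℝ (LinearMap.range L) ≤ 2 * k := by
      refine (Submodule.finrank_le _).trans ?_
      simp [two_mul]
    obtain ⟨w, hw, hwb⟩ : ∃ w ∈ LinearMap.ker L, w ∉ LinearMap.ker b := by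
      by_contra! hle
      have := Submodule.finrank_mono (show LinearMap.ker L ≤ LinearMap.ker b from hle)
      omega
    have hwe : ∀ i < k, b (e i) w = 0 := fun i hi => by
      have := congrFun (congrArg Prod.fst (LinearMap.mem_ker.1 hw)) ⟨i, hi⟩
      exact this
    have hwf : ∀ i < k, b (f i) w = 0 := fun i hi => by
      have := congrFun (congrArg Prod.snd (LinearMap.mem_ker.1 hw)) ⟨i, hi⟩
      exact this
    obtain ⟨u, hu⟩ : ∃ u, b w u ≠ 0 := by
      by_contra! h
      exact hwb (LinearMap.ext h)
    -- the component of `u` `b`-orthogonal to the pairs found so far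
    let u' : V := u - ∑ i ∈ Finset.range k, b (e i) u • f i + ∑ i ∈ Finset.range k, b (f i) u • e i
    have hue : ∀ j < k, b (e j) u' = 0 := fun j hj => by
      have h1 : ∑ i ∈ Finset.range k, b (e i) u * b (e j) (f i) = b (e j) u := by
        rw [Finset.sum_congr rfl fun i hi => by
          rw [(hef j hj i (Finset.mem_range.1 hi)).2.2, mul_ite, mul_one, mul_zero]]
        simp [hj]
      have h2 : ∑ i ∈ Finset.range k, b (f i) u * b (e j) (e i) = 0 :=
        Finset.sum_eq_zero fun i hi => by rw [(hef j hj i (Finset.mem_range.1 hi)).1, mul_zero]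
      simp [u', h1, h2]
    have huf : ∀ j < k, b (f j) u' = 0 := fun j hj => by
      have h1 : ∑ i ∈ Finset.range k, b (e i) u * b (f j) (f i) = 0 :=
        Finset.sum_eq_zero fun i hi => by rw [(hef j hj i (Finset.mem_range.1 hi)).2.1, mul_zero]
      have h2 : ∑ i ∈ Finset.range k, b (f i) u * b (f j) (e i) = -b (f j) u := by
        rw [Finset.sum_congr rfl fun i hi => by
          rw [skew (f j) (e i), (hef i (Finset.mem_range.1 hi) j hj).2.2, mul_neg, mul_ite, mul_one, mul_zero]]
        simp [hj]
      simp [u', h1, h2]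
    have hwu : b w u' = b w u := by
      have h1 : ∑ i ∈ Finset.range k, b (e i) u * b w (f i) = 0 :=
        Finset.sum_eq_zero fun i hi => by rw [skew w (f i), hwf i (Finset.mem_range.1 hi)]; simp
      have h2 : ∑ i ∈ Finset.range k, b (f i) u * b w (e i) = 0 :=
        Finset.sum_eq_zero fun i hi => by rw [skew w (e i), hwe i (Finset.mem_range.1 hi)]; simp
      simp [u', h1, h2]
    refine ⟨Function.update e k w, Function.update f k ((b w u)⁻¹ • u'), fun i hi j hj => ?_⟩
    rcases Nat.lt_succ_iff_lt_or_eq.1 hi with hi | rfl <;>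
      rcases Nat.lt_succ_iff_lt_or_eq.1 hj with hj | rfl
    · simpa [hi.ne, hj.ne] using hef i hi j hj
    · simp [hi.ne, hwe i hi, huf i hi, hue i hi]
    · have h1 : b w (e j) = 0 := by rw [skew, hwe j hj, neg_zero]
      have h2 : b w (f j) = 0 := by rw [skew, hwf j hj, neg_zero]
      have h3 : b u' (f j) = 0 := by rw [skew, huf j hj, neg_zero]
      simp [hj.ne, hj.ne', h1, h2, h3]
    · simp [hb, hwu, hu]

/-- A two-form whose `(k + 1)`-st power vanishes has rank at most `2 k`. -/
theorem finrank_le_of_wedgePow_eq_zero (b : V →ₗ[ℝ] V →ₗ[ℝ] ℝ) (hb : ∀ v, b v v = 0) {k : ℕ}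
    (h : wedgePow (twoAlt b hb) (k + 1) = 0) :
    finrank ℝ V ≤ finrank ℝ (LinearMap.ker b) + 2 * k := by
  by_contra! hlt
  obtain ⟨e, f, hef⟩ := exists_symplectic_family b hb (k + 1) (by omega)
  refine wedgePow_ne_zero_of_symplectic (twoAlt b hb)
    (fun a : Fin (k + 1) × Bool => if a.2 then f a.1 else e a.1) (fun a c => ?_) h
  rcases a with ⟨i, s⟩
  rcases c with ⟨j, t⟩
  have hs : b (f i) (e j) = -b (e j) (f i) := by
    have h := hb (f i + e j)
    simp only [map_add, LinearMap.add_apply, hb] at h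
    linarith
  obtain ⟨h1, h2, h3⟩ := hef i i.2 j j.2
  have h4 := (hef j j.2 i i.2).2.2
  cases s <;> cases t <;>
    simp [twoAlt, symplecticCoeff, h1, h2, h3, h4, hs, Fin.ext_iff, eq_comm, apply_ite]

end WedgeRank

/-! ### The characteristic distributions of a metric contact pair -/

section CharDist

variable {E : Type*} [NormedAddCommGroup E] [NormedSpace ℝ E] [FiniteDimensional ℝ E]
  {M : Type*} [TopologicalSpace M] [ChartedSpace E M] [IsManifold 𝓘(ℝ, E) ∞ M]
  {p q : ℕ} {α₁ α₂ : OneForm E M} {Z₁ Z₂ : VField E M} {φ : EndField E M}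
  {g : Metric E M}

theorem mem_charDist {α : OneForm E M} {x : M} {v : TangentSpace 𝓘(ℝ, E) x} :
    v ∈ charDist α x ↔ α x v = 0 ∧ ∀ w, dForm α x v w = 0 := by
  rw [charDist, Submodule.mem_inf, LinearMap.mem_ker, LinearMap.mem_ker]
  exact and_congr Iff.rfl ContinuousLinearMap.ext_iff

/-- The kernel of `dα` has codimension at most `2 k`, that of `α` at most one. -/
theorem finrank_le_finrank_charDist (α : OneForm E M) (x : M) {k : ℕ}
    (h : wedgePow (α.dAlt x) (k + 1) = 0) :
    finrank ℝ E ≤ finrank ℝ (charDist α x) + 2 * k + 1 := by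
  have := tangentSpace_finiteDimensional (E := E) x
  have hE : finrank ℝ (TangentSpace 𝓘(ℝ, E) x) = finrank ℝ E := rfl
  have h1 := finrank_le_of_wedgePow_eq_zero _ _ h
  have h2 : LinearMap.ker (ContinuousLinearMap.coeLM ℝ ∘ₗ (dForm α x).toLinearMap) =
      LinearMap.ker (dForm α x : TangentSpace 𝓘(ℝ, E) x →ₗ[ℝ] TangentSpace 𝓘(ℝ, E) x →L[ℝ] ℝ) :=
    LinearMap.ker_comp_of_ker_eq_bot _ (LinearMap.ker_eq_bot.2 ContinuousLinearMap.coe_injective)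
  rw [h2, hE] at h1
  have h3 := (α x : TangentSpace 𝓘(ℝ, E) x →ₗ[ℝ] ℝ).finrank_range_add_finrank_ker
  have h4 : finrank ℝ (LinearMap.range (α x : TangentSpace 𝓘(ℝ, E) x →ₗ[ℝ] ℝ)) ≤ 1 :=
    (Submodule.finrank_le _).trans (finrank_self ℝ).le
  have h5 := Submodule.finrank_sup_add_finrank_inf_eq
    (LinearMap.ker (α x : TangentSpace 𝓘(ℝ, E) x →ₗ[ℝ] ℝ))
    (LinearMap.ker (dForm α x : TangentSpace 𝓘(ℝ, E) x →ₗ[ℝ] TangentSpace 𝓘(ℝ, E) x →L[ℝ] ℝ))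
  have h6 := Submodule.finrank_le (LinearMap.ker (α x : TangentSpace 𝓘(ℝ, E) x →ₗ[ℝ] ℝ) ⊔
    LinearMap.ker (dForm α x : TangentSpace 𝓘(ℝ, E) x →ₗ[ℝ] TangentSpace 𝓘(ℝ, E) x →L[ℝ] ℝ))
  rw [hE] at h3 h6
  rw [charDist]
  omega

/-- `TM = T𝓕₁ ⊕ T𝓕₂`: the intersection is zero as `dα₁ + dα₂` is nondegenerate on
`ker α₁ ∩ ker α₂`, and the vanishing of `(dα₁)^(p+1)` and `(dα₂)^(q+1)` bounds the dimensions of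
the summands from below. -/
theorem IsMCP.charDist_sup_eq_top (H : IsMCP p q α₁ α₂ Z₁ Z₂ φ g) (x : M) :
    charDist α₁ x ⊔ charDist α₂ x = ⊤ := by
  have := tangentSpace_finiteDimensional (E := E) x
  have hE : finrank ℝ (TangentSpace 𝓘(ℝ, E) x) = finrank ℝ E := rfl
  have hinf : charDist α₁ x ⊓ charDist α₂ x = ⊥ := by
    refine (Submodule.eq_bot_iff _).2 fun v hv => ?_
    obtain ⟨h₁, h₂⟩ := Submodule.mem_inf.1 hv
    rw [mem_charDist] at h₁ h₂
    exact H.eq_zero_of_dForm_eq_zero h₁.1 h₂.1 fun w => by rw [h₁.2, h₂.2, add_zero]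
  have h1 := finrank_le_finrank_charDist α₁ x (H.1.1.pow_eq_zero₁ x)
  have h2 := finrank_le_finrank_charDist α₂ x (H.1.1.pow_eq_zero₂ x)
  have h3 := H.1.1.finrank_eq
  have h4 := Submodule.finrank_sup_add_finrank_inf_eq (charDist α₁ x) (charDist α₂ x)
  rw [hinf, finrank_bot] at h4
  refine Submodule.eq_top_of_finrank_eq (le_antisymm (Submodule.finrank_le _) ?_)
  rw [hE]
  omega

/-- `φ` is skew for `dα₁ + dα₂`, because `φ²` is symmetric. -/
theorem IsMCP.dForm_add_end (H : IsMCP p q α₁ α₂ Z₁ Z₂ φ g) (x : M)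
    (v w : TangentSpace 𝓘(ℝ, E) x) :
    (dForm α₁ x (φ x v) w + dForm α₁ x v (φ x w)) +
      (dForm α₂ x (φ x v) w + dForm α₂ x v (φ x w)) = 0 := by
  have h1 := H.inner_sq_apply x v w
  have h2 := H.inner_sq_apply x w v
  rw [H.inner_apply] at h1 h2
  rw [dForm_swap α₁ x w, dForm_swap α₂ x w, g.symm] at h2
  linarith

/-- If `φ` is decomposable, it is skew for `dα₁` itself: on `T𝓕₁` the form `dα₁` vanishes, and on
`T𝓕₂` it agrees with `dα₁ + dα₂`. -/
theorem IsMCP.dForm₁_end (H : IsMCP p q α₁ α₂ Z₁ Z₂ φ g)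
    (hφ : IsDecomposable (fun x => φ x) α₁ α₂) (x : M) (v w : TangentSpace 𝓘(ℝ, E) x) :
    dForm α₁ x (φ x v) w + dForm α₁ x v (φ x w) = 0 := by
  have htop := H.charDist_sup_eq_top x
  obtain ⟨a, ha, b, hb, rfl⟩ := Submodule.mem_sup.1 (htop ▸ Submodule.mem_top : v ∈ _)
  obtain ⟨c, hc, d, hd, rfl⟩ := Submodule.mem_sup.1 (htop ▸ Submodule.mem_top : w ∈ _)
  have e := H.dForm_add_end x b d
  have ha' := (mem_charDist.1 ha).2
  have hc' := (mem_charDist.1 hc).2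
  have hφa : ∀ u, dForm α₁ x (φ x a) u = 0 := (mem_charDist.1 (hφ.preserves₁ x a ha)).2
  have hφc : ∀ u, dForm α₁ x (φ x c) u = 0 := (mem_charDist.1 (hφ.preserves₁ x c hc)).2
  have hφb : ∀ u, dForm α₂ x (φ x b) u = 0 := (mem_charDist.1 (hφ.preserves₂ x b hb)).2
  rw [hφb, (mem_charDist.1 hb).2] at e
  simp only [map_add, _root_.add_apply, ha', hφa, dForm_swap α₁ x (φ x b) c, hc',
    dForm_swap α₁ x b (φ x c), hφc]
  linarith

theorem IsMCP.dForm₂_end (H : IsMCP p q α₁ α₂ Z₁ Z₂ φ g)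
    (hφ : IsDecomposable (fun x => φ x) α₁ α₂) (x : M) (v w : TangentSpace 𝓘(ℝ, E) x) :
    dForm α₂ x (φ x v) w + dForm α₂ x v (φ x w) = 0 := by
  simpa [H.dForm₁_end hφ] using H.dForm_add_end x v w

/-- If `φ` is skew for a `Z`-invariant two-form `dα`, then so is `𝓛_Z φ`. -/
theorem dForm_lieDeriv (α : OneForm E M) (φ : EndField E M) (Z : VField E M) {c : ℝ}
    (hc : ∀ x, α x (Z x) = c) (hd : ∀ x v, dForm α x (Z x) v = 0)
    (hskew : ∀ x v w, dForm α x (φ x v) w + dForm α x v (φ x w) = 0) (x : M)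
    (v w : TangentSpace 𝓘(ℝ, E) x) :
    dForm α x (lieDeriv Z φ x v) w + dForm α x v (lieDeriv Z φ x w) = 0 := by
  obtain ⟨X, hX, rfl⟩ := exists_contMDiffAt_extension x v
  obtain ⟨W, hW, rfl⟩ := exists_contMDiffAt_extension x w
  have mdf {a : M → ℝ} (ha : CMDiffAt ∞ a x) : MDiffAt a x := ha.mdifferentiableAt (by simp)
  have hφX := φ.contMDiffAt_apply hX
  have hφW := φ.contMDiffAt_apply hW
  have e : (fun y => dForm α y (φ y (X y)) (W y) + dForm α y (X y) (φ y (W y))) = fun _ => 0 := by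
    ext y; exact hskew y _ _
  have h := congrArg (fun f : M → ℝ => mvfderiv 𝓘(ℝ, E) f x (Z x)) e
  simp only [mvfderiv_fun_add (mdf (contMDiffAt_dForm_apply α hφX hW))
    (mdf (contMDiffAt_dForm_apply α hX hφW)), _root_.add_apply, mvfderiv_const, _root_.zero_apply,
    mvfderiv_dForm_apply α Z hc hd hφX hW, mvfderiv_dForm_apply α Z hc hd hX hφW,
    mlieBracket_endField_apply φ Z (hX.mdifferentiableAt (by simp)),
    mlieBracket_endField_apply φ Z (hW.mdifferentiableAt (by simp)), map_add] at h
  linarith [hskew x (mlieBracket 𝓘(ℝ, E) (fun y => Z y) X x) (W x),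
    hskew x (X x) (mlieBracket 𝓘(ℝ, E) (fun y => Z y) W x)]

/-- If `v` lies in `ker dα`, then `dα(A v, w) = -dα(v, A w) = 0`, so that `A v` does too. -/
theorem preserves_of_dForm_skew {α : OneForm E M}
    {A : Π x : M, TangentSpace 𝓘(ℝ, E) x →L[ℝ] TangentSpace 𝓘(ℝ, E) x}
    (h₀ : ∀ x v, α x (A x v) = 0) (hA : ∀ x v w, dForm α x (A x v) w + dForm α x v (A x w) = 0) :
    Preserves A α := by
  intro x v hv
  refine mem_charDist.2 ⟨h₀ x v, fun w => ?_⟩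
  have h := hA x v w
  rwa [(mem_charDist.1 hv).2, add_zero] at h

theorem trace_eq_zero_of_anticomm {V : Type*} [AddCommGroup V] [Module ℝ V] {A J : V →ₗ[ℝ] V}
    (h : A ∘ₗ J + J ∘ₗ A = 0) (hJ : J ∘ₗ J ∘ₗ A = -A) : LinearMap.trace ℝ V A = 0 := by
  have h1 : LinearMap.trace ℝ V (J ∘ₗ J ∘ₗ A) = LinearMap.trace ℝ V ((J ∘ₗ A) ∘ₗ J) :=
    LinearMap.trace_mul_comm ℝ J (J ∘ₗ A)
  have h2 : (J ∘ₗ A) ∘ₗ J = A := by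
    rw [LinearMap.comp_assoc, eq_neg_of_add_eq_zero_left h, LinearMap.comp_neg, hJ, neg_neg]
  rw [h2, hJ, map_neg] at h1
  linarith

/-! ### The tensor field `h` -/

theorem IsMCP.hTensor_anticomm (H : IsMCP p q α₁ α₂ Z₁ Z₂ φ g) (x : M)
    (v : TangentSpace 𝓘(ℝ, E) x) :
    hTensor Z₁ Z₂ φ x (φ x v) + φ x (hTensor Z₁ Z₂ φ x v) = 0 := by
  simp only [hTensor, _root_.smul_apply, map_smul, ← smul_add,
    H.lieDeriv_anticomm H.isReebCombination_add, smul_zero]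

theorem IsMCP.oneForm₁_hTensor (H : IsMCP p q α₁ α₂ Z₁ Z₂ φ g) (x : M)
    (v : TangentSpace 𝓘(ℝ, E) x) : α₁ x (hTensor Z₁ Z₂ φ x v) = 0 := by
  simp [hTensor, H.oneForm₁_lieDeriv H.isReebCombination_add]

theorem IsMCP.oneForm₂_hTensor (H : IsMCP p q α₁ α₂ Z₁ Z₂ φ g) (x : M)
    (v : TangentSpace 𝓘(ℝ, E) x) : α₂ x (hTensor Z₁ Z₂ φ x v) = 0 := by
  simp [hTensor, H.oneForm₂_lieDeriv H.isReebCombination_add]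

theorem IsMCP.sq_hTensor (H : IsMCP p q α₁ α₂ Z₁ Z₂ φ g) (x : M)
    (v : TangentSpace 𝓘(ℝ, E) x) :
    φ x (φ x (hTensor Z₁ Z₂ φ x v)) = -hTensor Z₁ Z₂ φ x v :=
  H.sq_apply_of_eq_zero (H.oneForm₁_hTensor x v) (H.oneForm₂_hTensor x v)

theorem IsMCP.isDecomposable_hTensor (H : IsMCP p q α₁ α₂ Z₁ Z₂ φ g)
    (hφ : IsDecomposable (fun x => φ x) α₁ α₂) :
    IsDecomposable (hTensor Z₁ Z₂ φ) α₁ α₂ where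
  preserves₁ := by
    refine preserves_of_dForm_skew H.oneForm₁_hTensor fun x v w => ?_
    have hZ := H.isReebCombination_add
    have h := dForm_lieDeriv α₁ φ (Z₁ + Z₂) hZ.apply₁ hZ.d_apply₁ (H.dForm₁_end hφ) x v w
    simp only [hTensor, _root_.smul_apply, map_smul, ← smul_add, h, smul_zero]
  preserves₂ := by
    refine preserves_of_dForm_skew H.oneForm₂_hTensor fun x v w => ?_
    have hZ := H.isReebCombination_add
    have h := dForm_lieDeriv α₂ φ (Z₁ + Z₂) hZ.apply₂ hZ.d_apply₂ (H.dForm₂_end hφ) x v w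
    simp only [hTensor, _root_.smul_apply, map_smul, ← smul_add, h, smul_zero]

theorem IsMCP.isSymmetricField_hTensor (H : IsMCP p q α₁ α₂ Z₁ Z₂ φ g) :
    IsSymmetricField g (hTensor Z₁ Z₂ φ) := by
  intro x v w
  simp only [hTensor, _root_.smul_apply, map_smul,
    H.isSymmetricField_lieDeriv H.isReebCombination_add x v w]

end CharDist

end MetricContactPair

theorem mainTheorem8
    {E : Type*} [NormedAddCommGroup E] [NormedSpace ℝ E] [FiniteDimensional ℝ E]
    {M : Type*} [TopologicalSpace M] [ChartedSpace E M] [IsManifold 𝓘(ℝ, E) ∞ M]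
    (p q : ℕ)
    (α₁ α₂ : MetricContactPair.OneForm E M) (Z₁ Z₂ : MetricContactPair.VField E M)
    (φ : MetricContactPair.EndField E M) (g : MetricContactPair.Metric E M)
    (hMCP : MetricContactPair.IsMCP p q α₁ α₂ Z₁ Z₂ φ g)
    (hφ : MetricContactPair.IsDecomposable (fun x => φ x) α₁ α₂) :
    ∃ hh : MetricContactPair.IsDecomposable (MetricContactPair.hTensor Z₁ Z₂ φ) α₁ α₂,
      -- (a)
      (MetricContactPair.IsSymmetricField g (MetricContactPair.lieDeriv Z₁ φ) ∧
        MetricContactPair.IsSymmetricField g (MetricContactPair.lieDeriv Z₂ φ) ∧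
        MetricContactPair.IsSymmetricField g (MetricContactPair.hTensor Z₁ Z₂ φ) ∧
        MetricContactPair.IsSymmetricOn g α₂ hh.fst ∧
        MetricContactPair.IsSymmetricOn g α₁ hh.snd) ∧
      -- (b)
      (∀ (x : M) (v : TangentSpace 𝓘(ℝ, E) x),
        MetricContactPair.leviCivita g (fun y => (Z₁ + Z₂) y) x v =
          -φ x v - φ x (MetricContactPair.hTensor Z₁ Z₂ φ x v)) ∧
      -- (c)
      (∀ x : M,
        MetricContactPair.hTensor Z₁ Z₂ φ x ∘L φ x +
          φ x ∘L MetricContactPair.hTensor Z₁ Z₂ φ x = 0 ∧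
        hh.fst x ∘ₗ hφ.fst x + hφ.fst x ∘ₗ hh.fst x = 0 ∧
        hh.snd x ∘ₗ hφ.snd x + hφ.snd x ∘ₗ hh.snd x = 0) ∧
      -- (d)
      (∀ x : M,
        LinearMap.trace ℝ (TangentSpace 𝓘(ℝ, E) x)
          (MetricContactPair.hTensor Z₁ Z₂ φ x).toLinearMap = 0 ∧
        LinearMap.trace ℝ (MetricContactPair.charDist α₂ x) (hh.fst x) = 0 ∧
        LinearMap.trace ℝ (MetricContactPair.charDist α₁ x) (hh.snd x) = 0) ∧
      -- (e)
      (∀ α ∈ ({α₁, α₂} : Set (MetricContactPair.OneForm E M)), ∀ x : M,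
        (∀ v : TangentSpace 𝓘(ℝ, E) x, α x (MetricContactPair.hTensor Z₁ Z₂ φ x v) = 0) ∧
        (∀ v : MetricContactPair.charDist α₂ x, α x (hh.fst x v) = 0) ∧
        (∀ v : MetricContactPair.charDist α₁ x, α x (hh.snd x v) = 0)) := by
  have c (x : M) : MetricContactPair.hTensor Z₁ Z₂ φ x ∘L φ x +
      φ x ∘L MetricContactPair.hTensor Z₁ Z₂ φ x = 0 :=
    ContinuousLinearMap.ext (hMCP.hTensor_anticomm x)
  have hh := hMCP.isDecomposable_hTensor hφ
  have cfst (x : M) : hh.fst x ∘ₗ hφ.fst x + hφ.fst x ∘ₗ hh.fst x = 0 :=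
    LinearMap.ext fun v => Subtype.ext (hMCP.hTensor_anticomm x v)
  have csnd (x : M) : hh.snd x ∘ₗ hφ.snd x + hφ.snd x ∘ₗ hh.snd x = 0 :=
    LinearMap.ext fun v => Subtype.ext (hMCP.hTensor_anticomm x v)
  have hsymm := hMCP.isSymmetricField_hTensor
  refine ⟨hh, ⟨hMCP.isSymmetricField_lieDeriv hMCP.isReebCombination₁,
    hMCP.isSymmetricField_lieDeriv hMCP.isReebCombination₂, hsymm,
    fun x v w => hsymm x v w, fun x v w => hsymm x v w⟩, hMCP.leviCivita_reeb,
    fun x => ⟨c x, cfst x, csnd x⟩, fun x => ⟨?_, ?_, ?_⟩, ?_⟩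
  · exact MetricContactPair.trace_eq_zero_of_anticomm
      (J := (φ x : TangentSpace 𝓘(ℝ, E) x →ₗ[ℝ] TangentSpace 𝓘(ℝ, E) x))
      (LinearMap.ext (hMCP.hTensor_anticomm x)) (LinearMap.ext (hMCP.sq_hTensor x))
  · exact MetricContactPair.trace_eq_zero_of_anticomm (cfst x)
      (LinearMap.ext fun v => Subtype.ext (hMCP.sq_hTensor x v))
  · exact MetricContactPair.trace_eq_zero_of_anticomm (csnd x)
      (LinearMap.ext fun v => Subtype.ext (hMCP.sq_hTensor x v))
  · rintro α (rfl | rfl) x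
    · exact ⟨hMCP.oneForm₁_hTensor x, fun v => hMCP.oneForm₁_hTensor x v,
        fun v => hMCP.oneForm₁_hTensor x v⟩
    · exact ⟨hMCP.oneForm₂_hTensor x, fun v => hMCP.oneForm₂_hTensor x v,
        fun v => hMCP.oneForm₂_hTensor x v⟩
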